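/- **Conventions.** Let $\mathfrak F$ be a small category and $\phi\colon\mathfrak F\to\mathbf{Top}$ a functor such that every space $\phi(V)$ is locally compact, second countable and Hausdorff; then $(\mathfrak F,\phi)$ is a *structure category* and $\phi$ a *fibre functor*. An $(\mathfrak F,\phi)$-*family* is a continuous map $p_X\colon X\to\bar X$ together with, for every $b\in\bar X$, an object $X_b$ of $\mathfrak F$ and a homeomorphism (chart) $\Phi_b\colon p_X^{-1}(b)\approx\phi(X_b)$. An $\mathfrak F$-*map* $X\to Y$ is a pair of continuous maps $(f\colon X\to Y,\ \bar f\colon\bar X\to\bar Y)$ with $p_Yf=\bar fp_X$ such that for every $b$ the map $\Phi_{\bar f b}\,f\,\Phi_b^{-1}\colon\phi(X_b)\to\phi(Y_{\bar f b})$ is $\phi(g)$ for some morphism $g$ of $\mathfrak F$. A family is an $\mathfrak F$-*bundle* if every point of the base has a neighbourhood $U$ such that the restriction $X|U$ is $\mathfrak F$-isomorphic to a product family $U\times\phi(W)\to U$. An object $V$ is identified with the family $\phi(V)\to *$. A *stratified space* is a space $\bar X$ with a filtration $\bar X_0\subset\bar X_1\subset\cdots\subset\bar X=\lim\bar X_i$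 such that $\bar X_0$ is homeomorphic to a CW-complex and, for $i\ge 1$, there are given a CW-pair $(\bar M_i,\bar A_i)$, a map $\bar h_i\colon\bar A_i\to\bar X_{i-1}$ and a push-out $\bar X_i=\bar X_{i-1}\cup_{\bar h_i}\bar M_i$; if infinitely many strata $\bar X_i\smallsetminus\bar X_{i-1}$ are non-empty, it is moreover assumed that for suitable CW-structures all the maps $\bar h_i$ are cellular. An $(\mathfrak F,\phi)$-*stratified bundle* is a stratified space $\bar X$ with an $(\mathfrak F,\phi)$-family $X\to\bar X$ such that $X_0=X|\bar X_0$ is an $\mathfrak F$-bundle; for every $i\ge1$ there are an $\mathfrak F$-bundle $M_i\to\bar M_i$ and an $\mathfrak F$-map $h_i\colon A_i=M_i|\bar A_i\to X_{i-1}=X|\bar X_{i-1}$ over $\bar h_i$ such that $X_i=X|\bar X_i$ is the push-out $X_{i-1}\cup_{h_i}M_i$ of $\mathfrak F$-families over the given push-out of base spaces; and $X=\lim X_i$. (A push-out of families along a closed inclusion consists of push-outs of the total spaces and of the base spaces, where the fibres of $X_i$ over $\bar X_{i-1}$ are those of $X_{i-1}$, and the fibres over $\bar X_i\smallsetminus\bar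 X_{i-1}=\bar M_i\smallsetminus\bar A_i$ are, up to $\mathfrak F$-isomorphism, those of $M_i$.) Let $\phi$ be faithful. For a family $Y$ and an object $V$ let $Y^V$ be the set of $\mathfrak F$-maps $V\to Y$ with the compact-open topology, and for $K\subset\phi(V)$ and $U\subset Y$ let $N_{K,U}=\{f\in Y^V: f(K)\subset U\}$. Let $\phi^V\colon\mathfrak F\to\mathbf{Top}$ be the functor which sends $W$ to $W^V=\hom_{\mathfrak F}(V,W)$ with the compact-open topology. If $\phi(V)\neq\emptyset$, then $Y^V$ is an $(\mathfrak F,\phi^V)$-family over $\bar Y$: the projection sends an $\mathfrak F$-map $f$ to the point $b$ over which it lies, and the chart at $b$ sends $f$ to the unique morphism $g\colon V\to Y_b$ with $\phi(g)=\Phi_b f$. A family $\mathcal K$ of compact subsets of $\phi(V)$ is *generating* if for every $(\mathfrak F,\phi)$-family $Y$ the sets $N_{K,U}$, with $K\in\mathcal K$ and $U$ open in $Y$, form a subbasis of the topology of $Y^V$. The structure category $(\mathfrak F,\phi)$, with $\phi$ faithful, is *NKC* if every object $V$ has a generating family $\mathcal K$ such that for all $K\in\mathcal K$, all objects $W$ and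 all compact $C\subset\phi(W)$ the subspace $N_{K,C}\subset\hom_{\mathfrak F}(V,W)$ is compact. **Theorem.** Let $(\mathfrak F,\phi)$ be an NKC structure category, let $X\to\bar X$ be an $(\mathfrak F,\phi)$-stratified bundle, and let $V$ be an object of $\mathfrak F$ with $\phi(V)\ne\emptyset$. Then $(\mathfrak F,\phi^V)$ is a structure category, i.e. all spaces $\hom_{\mathfrak F}(V,W)$ are locally compact, second countable and Hausdorff, and the function space $X^V\to\bar X$ is an $(\mathfrak F,\phi^V)$-stratified bundle over the same stratified space $\bar X$. -/

import Mathlib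

open CategoryTheory Topology

universe u

namespace StratBundle

/-! ### Structure categories and fibre families -/

/-- The assumption on a fibre functor `φ` on a small category `F`: every space `φ V` is
locally compact, second countable and Hausdorff. Such a pair `(F, φ)` is a structure category. -/
structure IsFibreFunctor {F : Type u} [SmallCategory F] (φ : F ⥤ TopCat.{u}) : Prop where
  locallyCompact : ∀ V : F, LocallyCompactSpace (φ.obj V)
  secondCountable : ∀ V : F, SecondCountableTopology (φ.obj V)
  t2 : ∀ V : F, T2Space (φ.obj V)

/-- An `(F, φ)`-family over `B`: a map `proj : Total → B` together with, for each `b : B`,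
an object `fib b` of `F` and a chart `proj ⁻¹ {b} ≃ₜ φ (fib b)`. -/
structure FibreFamily {F : Type u} [SmallCategory F] (φ : F ⥤ TopCat.{u})
    (B : Type u) [TopologicalSpace B] where
  Total : Type u
  [topTotal : TopologicalSpace Total]
  proj : C(Total, B)
  fib : B → F
  chart : ∀ b : B, (proj ⁻¹' {b} : Set Total) ≃ₜ φ.obj (fib b)

attribute [instance] FibreFamily.topTotal

/-- An `F`-map of families: a commutative square of continuous maps which, read in the charts,
is on every fibre the image under `φ` of a morphism of `F`. -/
structure FMap {F : Type u} [SmallCategory F] {φ : F ⥤ TopCat.{u}}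
    {B B' : Type u} [TopologicalSpace B] [TopologicalSpace B']
    (X : FibreFamily φ B) (Y : FibreFamily φ B') where
  toMap : C(X.Total, Y.Total)
  base : C(B, B')
  comm : ∀ x, Y.proj (toMap x) = base (X.proj x)
  fibre : ∀ b : B, ∃ g : X.fib b ⟶ Y.fib (base b), ∀ x : (X.proj ⁻¹' {b} : Set X.Total),
    (φ.map g).hom (X.chart b x) =
      Y.chart (base b) ⟨toMap x, (comm x).trans (congrArg base x.2)⟩

/-- The `F`-map `f` is an `F`-isomorphism on the fibre over `b`: read in the charts, it is
`φ g`, with an inverse of the form `φ g'`. -/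
def FMap.IsFibreIsoAt {F : Type u} [SmallCategory F] {φ : F ⥤ TopCat.{u}}
    {B B' : Type u} [TopologicalSpace B] [TopologicalSpace B']
    {X : FibreFamily φ B} {Y : FibreFamily φ B'} (f : FMap X Y) (b : B) : Prop :=
  ∃ (g : X.fib b ⟶ Y.fib (f.base b)) (g' : Y.fib (f.base b) ⟶ X.fib b),
    (∀ x : (X.proj ⁻¹' {b} : Set X.Total),
      (φ.map g).hom (X.chart b x) =
        Y.chart (f.base b) ⟨f.toMap x, (f.comm x).trans (congrArg f.base x.2)⟩) ∧
    φ.map g ≫ φ.map g' = 𝟙 _ ∧ φ.map g' ≫ φ.map g = 𝟙 _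

/-- `X` and `Y` are `F`-isomorphic: there are mutually inverse `F`-maps between them. -/
def FIsomorphic {F : Type u} [SmallCategory F] {φ : F ⥤ TopCat.{u}}
    {B B' : Type u} [TopologicalSpace B] [TopologicalSpace B']
    (X : FibreFamily φ B) (Y : FibreFamily φ B') : Prop :=
  ∃ (f : FMap X Y) (g : FMap Y X),
    (∀ x, g.toMap (f.toMap x) = x) ∧ (∀ y, f.toMap (g.toMap y) = y) ∧
    (∀ b, g.base (f.base b) = b) ∧ (∀ b', f.base (g.base b') = b')

/-- The point family `φ V → *`. -/
def pointFamily {F : Type u} [SmallCategory F] (φ : F ⥤ TopCat.{u}) (V : F) :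
    FibreFamily φ PUnit.{u + 1} where
  Total := φ.obj V
  proj := ContinuousMap.const _ PUnit.unit
  fib := fun _ => V
  chart := fun _ =>
    { toFun := fun x => x.1
      invFun := fun x => ⟨x, rfl⟩
      left_inv := fun _ => rfl
      right_inv := fun _ => rfl
      continuous_toFun := continuous_subtype_val
      continuous_invFun := continuous_id.subtype_mk _ }

/-- The product family `B × φ W → B`. -/
def productFamily {F : Type u} [SmallCategory F] (φ : F ⥤ TopCat.{u}) (W : F)
    (B : Type u) [TopologicalSpace B] : FibreFamily φ B where
  Total := B × φ.obj W
  proj := ContinuousMap.fst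
  fib := fun _ => W
  chart := fun b =>
    { toFun := fun x => x.1.2
      invFun := fun w => ⟨(b, w), rfl⟩
      left_inv := fun x => Subtype.ext (Prod.ext (Eq.symm x.2) rfl)
      right_inv := fun _ => rfl
      continuous_toFun := continuous_snd.comp continuous_subtype_val
      continuous_invFun := (continuous_const.prodMk continuous_id).subtype_mk _ }

/-- The restriction `X|U` of a family to a subspace `U` of the base. -/
def FibreFamily.restrict {F : Type u} [SmallCategory F] {φ : F ⥤ TopCat.{u}}
    {B : Type u} [TopologicalSpace B] (X : FibreFamily φ B) (U : Set B) :
    FibreFamily φ U where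
  Total := (X.proj ⁻¹' U : Set X.Total)
  proj := ⟨fun x => ⟨X.proj x.1, x.2⟩, by fun_prop⟩
  fib := fun b => X.fib b.1
  chart := fun b =>
    Homeomorph.trans
      { toFun := fun x => ⟨x.1.1, congrArg Subtype.val x.2⟩
        invFun := fun x => ⟨⟨x.1, Set.mem_of_eq_of_mem (s := U) (show X.proj x.1 = b.1 from x.2) b.2⟩,
          Subtype.ext x.2⟩
        left_inv := fun _ => rfl
        right_inv := fun _ => rfl
        continuous_toFun := by fun_prop
        continuous_invFun := by fun_prop }
      (X.chart b.1)

/-- The inclusion `X|U → X` as an `F`-map. -/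
def FibreFamily.restrictIncl {F : Type u} [SmallCategory F] {φ : F ⥤ TopCat.{u}}
    {B : Type u} [TopologicalSpace B] (X : FibreFamily φ B) (U : Set B) :
    FMap (X.restrict U) X where
  toMap := ⟨Subtype.val, continuous_subtype_val⟩
  base := ⟨Subtype.val, continuous_subtype_val⟩
  comm := fun _ => rfl
  fibre := fun b => ⟨𝟙 (X.fib b.1), fun x =>
    congrArg (fun a : φ.obj (X.fib b.1) ⟶ φ.obj (X.fib b.1) => a.hom (show φ.obj (X.fib b.1) from (X.restrict U).chart b x))
      (φ.map_id (X.fib b.1))⟩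

/-- The inclusion `X|U → X|U'` for `U ⊆ U'` as an `F`-map. -/
def FibreFamily.restrictLE {F : Type u} [SmallCategory F] {φ : F ⥤ TopCat.{u}}
    {B : Type u} [TopologicalSpace B] (X : FibreFamily φ B) {U U' : Set B} (h : U ⊆ U') :
    FMap (X.restrict U) (X.restrict U') where
  toMap := ⟨fun x => ⟨x.1, h x.2⟩, by fun_prop⟩
  base := ⟨fun b => ⟨b.1, h b.2⟩, by fun_prop⟩
  comm := fun _ => rfl
  fibre := fun b => ⟨𝟙 (X.fib b.1), fun x =>
    congrArg (fun a : φ.obj (X.fib b.1) ⟶ φ.obj (X.fib b.1) => a.hom (show φ.obj (X.fib b.1) from (X.restrict U).chart b x))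
      (φ.map_id (X.fib b.1))⟩

/-- A trivial `F`-bundle: a family `F`-isomorphic to a product family. -/
def FibreFamily.IsTrivial {F : Type u} [SmallCategory F] {φ : F ⥤ TopCat.{u}}
    {B : Type u} [TopologicalSpace B] (X : FibreFamily φ B) : Prop :=
  ∃ W : F, FIsomorphic X (productFamily φ W B)

/-- An `F`-bundle: a locally trivial family. -/
def FibreFamily.IsBundle {F : Type u} [SmallCategory F] {φ : F ⥤ TopCat.{u}}
    {B : Type u} [TopologicalSpace B] (X : FibreFamily φ B) : Prop :=
  ∀ b : B, ∃ U ∈ 𝓝 b, (X.restrict U).IsTrivial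

/-- A push-out square of `F`-families
```
A --f--> X
|i       |j
v        v
Y --k--> Z
```
along a closed inclusion `i`: base spaces and total spaces form push-outs of topological spaces,
and the charts of `Z` are, up to `F`-isomorphism, those of `X` over the image of the base of `X`
and those of `Y` over the complement of the base of `A`. -/
structure IsFPushout {F : Type u} [SmallCategory F] {φ : F ⥤ TopCat.{u}}
    {BA BX BY BZ : Type u} [TopologicalSpace BA] [TopologicalSpace BX] [TopologicalSpace BY]
    [TopologicalSpace BZ] {A : FibreFamily φ BA} {X : FibreFamily φ BX} {Y : FibreFamily φ BY}
    {Z : FibreFamily φ BZ} (f : FMap A X) (i : FMap A Y) (j : FMap X Z) (k : FMap Y Z) :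
    Prop where
  base : IsPushout (TopCat.ofHom f.base) (TopCat.ofHom i.base)
    (TopCat.ofHom j.base) (TopCat.ofHom k.base)
  total : IsPushout (TopCat.ofHom f.toMap) (TopCat.ofHom i.toMap)
    (TopCat.ofHom j.toMap) (TopCat.ofHom k.toMap)
  fibre_left : ∀ b : BX, j.IsFibreIsoAt b
  fibre_right : ∀ b : BY, b ∉ Set.range i.base → k.IsFibreIsoAt b

/-! ### Stratified spaces -/

/-- The data of a stratified space `B`: a filtration `filt 0 ⊆ filt 1 ⊆ ⋯` of `B`, whose colimit
is `B`, such that `filt 0` is a CW-space and `filt (i + 1)` is the push-out of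
`M i ⊇ A i → filt i` for a CW-pair `(M i, A i)`. (The pair `(M i, A i)` is the one attached to
`filt i`, so indices are shifted by one.) -/
structure StratificationData (B : Type u) [TopologicalSpace B] where
  filt : ℕ → Set B
  filt_le : ∀ i, filt i ⊆ filt (i + 1)
  iUnion_filt : ⋃ i, filt i = Set.univ
  coherent : IsCoherentWith (Set.range filt)
  t2_zero : T2Space (filt 0)
  cw_zero : Nonempty (CWComplex (Set.univ : Set (filt 0)))
  M : ℕ → Type u
  [topM : ∀ i, TopologicalSpace (M i)]
  t2_M : ∀ i, T2Space (M i)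
  A : ∀ i, Set (M i)
  cw_pair : ∀ i, ∃ (_ : CWComplex (Set.univ : Set (M i)))
    (E : RelCWComplex.Subcomplex (Set.univ : Set (M i))), (E : Set (M i)) = A i
  attach : ∀ i, C(A i, filt i)
  char : ∀ i, C(M i, filt (i + 1))
  isPushout : ∀ i, IsPushout (TopCat.ofHom (attach i))
    (TopCat.ofHom (⟨Subtype.val, continuous_subtype_val⟩ : C(A i, M i)))
    (TopCat.ofHom (⟨Set.inclusion (filt_le i), continuous_inclusion (filt_le i)⟩ :
      C(filt i, filt (i + 1))))
    (TopCat.ofHom (char i))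

attribute [instance] StratificationData.topM StratificationData.t2_zero StratificationData.t2_M

/-- For given CW-structures on `filt 0` and on the spaces `M i`, the `n`-skeleton of `filt i`:
the `n`-skeleton of `filt 0` together with the images of the `n`-skeleta of
`M 0, …, M (i - 1)`. -/
def StratificationData.skel {B : Type u} [TopologicalSpace B] (S : StratificationData B)
    (c₀ : CWComplex (Set.univ : Set (S.filt 0)))
    (c : ∀ i, CWComplex (Set.univ : Set (S.M i))) (n : ℕ) : ℕ → Set B
  | 0 => (fun x : S.filt 0 => (x : B)) ''
      (RelCWComplex.skeleton (Set.univ : Set (S.filt 0)) n : Set (S.filt 0))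
  | i + 1 => S.skel c₀ c n i ∪ (fun m : S.M i => (S.char i m : B)) ''
      (RelCWComplex.skeleton (Set.univ : Set (S.M i)) n : Set (S.M i))

/-- The number of non-empty strata is finite. -/
def StratificationData.IsFinite {B : Type u} [TopologicalSpace B]
    (S : StratificationData B) : Prop :=
  {i : ℕ | (S.filt (i + 1) \ S.filt i).Nonempty}.Finite

/-- A stratified CW-complex: for suitable CW-structures on the attached spaces, all attaching
maps are cellular (where `A i` is a subcomplex of `M i`, and `filt i` carries the CW-structure
obtained from the previous attachings). -/
def StratificationData.IsStratifiedCW {B : Type u} [TopologicalSpace B]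
    (S : StratificationData B) : Prop :=
  ∃ (c₀ : CWComplex (Set.univ : Set (S.filt 0)))
    (c : ∀ i, CWComplex (Set.univ : Set (S.M i))),
    (∀ i, ∃ E : RelCWComplex.Subcomplex (Set.univ : Set (S.M i)), (E : Set (S.M i)) = S.A i) ∧
    ∀ (i n : ℕ) (a : S.A i),
      (a : S.M i) ∈ (RelCWComplex.skeleton (Set.univ : Set (S.M i)) n : Set (S.M i)) →
      (S.attach i a : B) ∈ S.skel c₀ c n i

/-- A stratified space; one that is not finite is required to be a stratified CW-complex. -/
structure StratifiedSpace (B : Type u) [TopologicalSpace B] extends StratificationData B where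
  finite_or_cellular : toStratificationData.IsFinite ∨ toStratificationData.IsStratifiedCW

/-- The family `X` over the stratified space `B` is an `(F, φ)`-stratified bundle: `X|filt 0` is
an `F`-bundle, each `X|filt (i + 1)` is the push-out, covering the given push-out of base spaces,
of an `F`-bundle `M` over `M i` and of `X|filt i` along an `F`-map defined on `M|A i`,
and `X` is the colimit of the spaces `X|filt i`. -/
structure IsStratifiedBundle {F : Type u} [SmallCategory F] {φ : F ⥤ TopCat.{u}}
    {B : Type u} [TopologicalSpace B] (S : StratifiedSpace B) (X : FibreFamily φ B) :
    Prop where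
  bundle_zero : (X.restrict (S.filt 0)).IsBundle
  attaching : ∀ i, ∃ M : FibreFamily φ (S.M i), M.IsBundle ∧
    ∃ (h : FMap (M.restrict (S.A i)) (X.restrict (S.filt i)))
      (k : FMap M (X.restrict (S.filt (i + 1)))),
      h.base = S.attach i ∧ k.base = S.char i ∧
      IsFPushout h (M.restrictIncl (S.A i)) (X.restrictLE (S.filt_le i)) k
  coherent : IsCoherentWith (Set.range fun i => (X.proj ⁻¹' S.filt i : Set X.Total))

/-! ### Function spaces and the NKC property -/

/-- The set of morphisms `V ⟶ W` of `F`, with the compact-open topology. -/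
def HomSpace {F : Type u} [SmallCategory F] (_φ : F ⥤ TopCat.{u}) (V W : F) : Type u := V ⟶ W

instance {F : Type u} [SmallCategory F] (φ : F ⥤ TopCat.{u}) (V W : F) :
    TopologicalSpace (HomSpace φ V W) :=
  TopologicalSpace.induced
    (fun g : V ⟶ W => ((φ.map g).hom : C(φ.obj V, φ.obj W))) inferInstance

theorem HomSpace.isInducing {F : Type u} [SmallCategory F] (φ : F ⥤ TopCat.{u}) (V W : F) :
    IsInducing (fun g : HomSpace φ V W =>
      ((φ.map (show V ⟶ W from g)).hom : C(φ.obj V, φ.obj W))) :=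
  ⟨rfl⟩

/-- The functor `φ^V`, which sends `W` to `hom(V, W)` with the compact-open topology. -/
def homFunctor {F : Type u} [SmallCategory F] (φ : F ⥤ TopCat.{u}) (V : F) :
    F ⥤ TopCat.{u} where
  obj W := TopCat.of (HomSpace φ V W)
  map {W W'} a := TopCat.ofHom
    { toFun := fun g : HomSpace φ V W => (show V ⟶ W from g) ≫ a
      continuous_toFun := by
        refine (HomSpace.isInducing φ V W').continuous_iff.2 ?_
        refine ((ContinuousMap.continuous_postcomp
          ((φ.map a).hom : C(φ.obj W, φ.obj W'))).comp
            (HomSpace.isInducing φ V W).continuous).congr fun g => ?_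
        exact (congrArg TopCat.Hom.hom (φ.map_comp (show V ⟶ W from g) a)).symm }
  map_id W := by
    ext g
    exact Category.comp_id (show V ⟶ W from g)
  map_comp a b := by
    ext g
    exact (Category.assoc (show V ⟶ _ from g) a b).symm

/-- The space `Y^V` of all `F`-maps from the point family `V` to `Y`. -/
def FunctionSpace {F : Type u} [SmallCategory F] {φ : F ⥤ TopCat.{u}}
    {B : Type u} [TopologicalSpace B] (Y : FibreFamily φ B) (V : F) : Type u :=
  FMap (pointFamily φ V) Y

/-- The underlying continuous map `φ V → Y` of a point of `Y^V`. -/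
def FunctionSpace.map {F : Type u} [SmallCategory F] {φ : F ⥤ TopCat.{u}}
    {B : Type u} [TopologicalSpace B] {Y : FibreFamily φ B} {V : F} (f : FunctionSpace Y V) :
    C(φ.obj V, Y.Total) :=
  FMap.toMap f

/-- The point of the base over which a point of `Y^V` lies. -/
def FunctionSpace.pt {F : Type u} [SmallCategory F] {φ : F ⥤ TopCat.{u}}
    {B : Type u} [TopologicalSpace B] {Y : FibreFamily φ B} {V : F} (f : FunctionSpace Y V) : B :=
  FMap.base f PUnit.unit

/-- The compact-open topology on `Y^V`. -/
instance {F : Type u} [SmallCategory F] {φ : F ⥤ TopCat.{u}}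
    {B : Type u} [TopologicalSpace B] (Y : FibreFamily φ B) (V : F) :
    TopologicalSpace (FunctionSpace Y V) :=
  TopologicalSpace.induced FunctionSpace.map inferInstance

/-- The set `N_{K,U}` of the points `f` of `Y^V` with `f(K) ⊆ U`. -/
def FunctionSpace.N {F : Type u} [SmallCategory F] {φ : F ⥤ TopCat.{u}}
    {B : Type u} [TopologicalSpace B] (Y : FibreFamily φ B) (V : F)
    (K : Set (φ.obj V)) (U : Set Y.Total) : Set (FunctionSpace Y V) :=
  {f | Set.MapsTo f.map K U}

/-- A generating family of compact subsets of `φ V`: for every `(F, φ)`-family `Y`, the sets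
`N_{K,U}`, with `K` in the family and `U` open in `Y`, form a subbasis of the topology of `Y^V`. -/
structure IsGenerating {F : Type u} [SmallCategory F] (φ : F ⥤ TopCat.{u}) (V : F)
    (𝒦 : Set (Set (φ.obj V))) : Prop where
  isCompact : ∀ K ∈ 𝒦, IsCompact K
  subbasis : ∀ (B : Type u) [TopologicalSpace B] (Y : FibreFamily φ B),
    (inferInstance : TopologicalSpace (FunctionSpace Y V)) = TopologicalSpace.generateFrom
      {s | ∃ K ∈ 𝒦, ∃ U : Set Y.Total, IsOpen U ∧ s = FunctionSpace.N Y V K U}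

/-- `(F, φ)` is an NKC structure category, for a faithful functor `φ`: the sets `N_{K,C}` in the
spaces `hom(V, W)` are compact for all compact `C` and all `K` in a generating family of `V`. -/
structure IsNKC {F : Type u} [SmallCategory F] (φ : F ⥤ TopCat.{u}) [φ.Faithful] : Prop where
  isFibreFunctor : IsFibreFunctor φ
  exists_generating : ∀ V : F, ∃ 𝒦 : Set (Set (φ.obj V)), IsGenerating φ V 𝒦 ∧
    ∀ K ∈ 𝒦, ∀ (W : F) (C : Set (φ.obj W)), IsCompact C →
      IsCompact {g : HomSpace φ V W | Set.MapsTo (φ.map (show V ⟶ W from g)).hom K C}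

theorem FunctionSpace.isInducing {F : Type u} [SmallCategory F] {φ : F ⥤ TopCat.{u}}
    {B : Type u} [TopologicalSpace B] (Y : FibreFamily φ B) (V : F) :
    IsInducing (FunctionSpace.map : FunctionSpace Y V → C(φ.obj V, Y.Total)) :=
  ⟨rfl⟩

theorem FunctionSpace.proj_map {F : Type u} [SmallCategory F] {φ : F ⥤ TopCat.{u}}
    {B : Type u} [TopologicalSpace B] {Y : FibreFamily φ B} {V : F} (f : FunctionSpace Y V)
    (v : φ.obj V) : Y.proj (f.map v) = f.pt :=
  FMap.comm f v

theorem FunctionSpace.exists_hom {F : Type u} [SmallCategory F] {φ : F ⥤ TopCat.{u}}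
    {B : Type u} [TopologicalSpace B] {Y : FibreFamily φ B} {V : F} (f : FunctionSpace Y V)
    {b : B} (hb : f.pt = b) : ∃ g : V ⟶ Y.fib b, ∀ v : φ.obj V,
      (φ.map g).hom v = Y.chart b ⟨f.map v, (f.proj_map v).trans hb⟩ := by
  subst hb
  obtain ⟨g, hg⟩ := FMap.fibre f PUnit.unit
  exact ⟨g, fun v => hg ⟨v, rfl⟩⟩

theorem FunctionSpace.ext {F : Type u} [SmallCategory F] {φ : F ⥤ TopCat.{u}}
    {B : Type u} [TopologicalSpace B] {Y : FibreFamily φ B} {V : F} {f f' : FunctionSpace Y V}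
    (h : f.map = f'.map) (h' : f.pt = f'.pt) : f = f' := by
  have h₂ : FMap.base f = FMap.base f' := ContinuousMap.ext fun _ => h'
  have h₁ : FMap.toMap f = FMap.toMap f' := h
  rcases f with ⟨a, b, c, d⟩
  rcases f' with ⟨a', b', c', d'⟩
  dsimp only at h₁ h₂
  subst h₁
  subst h₂
  rfl

/-- The point of `Y^V` over `b` which in the chart at `b` is the morphism `g`. -/
def FunctionSpace.ofHom {F : Type u} [SmallCategory F] {φ : F ⥤ TopCat.{u}}
    {B : Type u} [TopologicalSpace B] (Y : FibreFamily φ B) (V : F) (b : B) (g : V ⟶ Y.fib b) :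
    FunctionSpace Y V where
  toMap := ⟨fun v : φ.obj V => ((Y.chart b).symm ((φ.map g).hom v)).1,
    continuous_subtype_val.comp ((Y.chart b).symm.continuous.comp (φ.map g).hom.continuous)⟩
  base := ContinuousMap.const _ b
  comm := fun v => ((Y.chart b).symm ((φ.map g).hom v)).2
  fibre := fun _ => ⟨g, fun x => ((Y.chart b).apply_symm_apply ((φ.map g).hom x.1)).symm⟩

/-- The `(F, φ^V)`-family `Y^V → B` associated with an `(F, φ)`-family `Y → B`. The projection
sends `f : V → Y` to the point of `B` over which `f` lies, and the chart at `b` sends an `F`-map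
`f` over `b` to the morphism `g : V ⟶ Y.fib b` for which `φ g` is `f` read in the chart
of `Y` at `b`. -/
noncomputable def FibreFamily.functionFamily {F : Type u} [SmallCategory F]
    {φ : F ⥤ TopCat.{u}} [φ.Faithful] {B : Type u} [TopologicalSpace B] (Y : FibreFamily φ B)
    (V : F) [Nonempty (φ.obj V)] : FibreFamily (homFunctor φ V) B where
  Total := FunctionSpace Y V
  proj :=
    { toFun := FunctionSpace.pt
      continuous_toFun := by
        have v₀ : φ.obj V := Classical.arbitrary _
        have h : Continuous fun f : FunctionSpace Y V => Y.proj (f.map v₀) :=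
          Y.proj.continuous.comp
            ((continuous_eval_const v₀).comp (FunctionSpace.isInducing Y V).continuous)
        exact h.congr fun f => f.proj_map v₀ }
  fib := Y.fib
  chart := fun b =>
    { toFun := fun f => (f.1.exists_hom f.2).choose
      invFun := fun g => ⟨FunctionSpace.ofHom Y V b g, rfl⟩
      left_inv := by
        rintro ⟨f, hf⟩
        refine Subtype.ext (FunctionSpace.ext (ContinuousMap.ext fun v => ?_) (Eq.symm hf))
        exact congrArg Subtype.val ((Y.chart b).symm_apply_eq.2
          ((f.exists_hom hf).choose_spec v))
      right_inv := by
        intro g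
        refine φ.map_injective (TopCat.hom_ext (ContinuousMap.ext fun v => ?_))
        refine (((FunctionSpace.ofHom Y V b g).exists_hom rfl).choose_spec v).trans ?_
        exact (Y.chart b).apply_symm_apply ((φ.map g).hom v)
      continuous_toFun := by
        refine (HomSpace.isInducing φ V (Y.fib b)).continuous_iff.2 ?_
        let r : (FunctionSpace.pt ⁻¹' {b} : Set (FunctionSpace Y V)) →
            C(φ.obj V, (Y.proj ⁻¹' {b} : Set Y.Total)) := fun f =>
          ⟨fun v => ⟨f.1.map v, (f.1.proj_map v).trans f.2⟩,
            f.1.map.continuous.subtype_mk _⟩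
        have hr : Continuous r :=
          (ContinuousMap.isInducing_postcomp (⟨Subtype.val, continuous_subtype_val⟩ :
              C((Y.proj ⁻¹' {b} : Set Y.Total), Y.Total)) IsInducing.subtypeVal).continuous_iff.2
            ((FunctionSpace.isInducing Y V).continuous.comp continuous_subtype_val)
        refine ((ContinuousMap.continuous_postcomp
          (⟨Y.chart b, (Y.chart b).continuous⟩ :
            C((Y.proj ⁻¹' {b} : Set Y.Total), φ.obj (Y.fib b)))).comp hr).congr fun f => ?_
        exact (ContinuousMap.ext fun v => (f.1.exists_hom f.2).choose_spec v).symm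
      continuous_invFun := by
        refine Continuous.subtype_mk ((FunctionSpace.isInducing Y V).continuous_iff.2 ?_) _
        exact (ContinuousMap.continuous_postcomp
          (⟨fun w => ((Y.chart b).symm w).1,
            continuous_subtype_val.comp (Y.chart b).symm.continuous⟩ :
            C(φ.obj (Y.fib b), Y.Total))).comp (HomSpace.isInducing φ V (Y.fib b)).continuous }

end StratBundle

open StratBundle

namespace StratBundle

section

variable {F : Type u} [SmallCategory F] {φ : F ⥤ TopCat.{u}}

/-! ### Functoriality of families and function spaces -/

section Maps

variable {B B' B'' : Type u} [TopologicalSpace B] [TopologicalSpace B'] [TopologicalSpace B'']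

/-! An `F`-map out of `V` lies over a single point of the base, so passing from `X` to `X ^ V`
leaves the base unchanged. Over a trivializing set, `(U × φ W) ^ V` is `U × hom(V, W)`, so bundles
give bundles. An `F`-map `V → Z` into a push-out `Z` lifts to one of the two pieces because the
canonical maps are `F`-isomorphisms on the relevant fibres; hence `Z ^ V` is the push-out at the
level of sets. The real content is topological: the compact-open topology must be the push-out
topology and, for the whole filtration, the colimit topology.

Let `U` be a subset of `Z ^ V` whose preimages in the function spaces of the pieces are open. Near a
point coming from `X`, the preimage of `U` contains a finite intersection of sets `N_{K j, O j}`. It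
suffices to extend the `O j` to open sets of `Z` whose intersection of `N_{K j, O' j}` still lies in
`U` (`IsFPushout.exists_isOpen_extension`). On the attached bundle `M` this is an extension problem
from a subcomplex: no `F`-map in the closed complement of `U` may send every `K j` into the extended
set.

NKC solves it over one compact base. In a bundle the sets `N_{K,L}` are compact for compact `L` and
suitable `K` (`IsProperTest.isCompact_mapsTo`). If every system of compact neighbourhoods of given
compact sets admitted a bad `F`-map, compactness would give a bad `F`-map for the compact sets
themselves (`exists_compact_nhds_extension`). Exhausting open sets by compact ones gives
`exists_isOpen_extension`; induction over skeleta gives `exists_isOpen_extension_subcomplex`.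
Iterating the extension through all strata proves the colimit statement
`IsStratifiedBundle.isCoherentWith_functionSpace`. -/

/-- Composition of `F`-maps. -/
def FMap.comp {X : FibreFamily φ B} {Y : FibreFamily φ B'} {Z : FibreFamily φ B''}
    (g : FMap Y Z) (f : FMap X Y) : FMap X Z where
  toMap := g.toMap.comp f.toMap
  base := g.base.comp f.base
  comm := fun x => (g.comm (f.toMap x)).trans (congrArg g.base (f.comm x))
  fibre := fun b => by
    obtain ⟨a, ha⟩ := f.fibre b
    obtain ⟨c, hc⟩ := g.fibre (f.base b)
    refine ⟨a ≫ c, fun x => ?_⟩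
    refine (congrArg (fun d => (TopCat.Hom.hom d) (X.chart b x)) (φ.map_comp a c)).trans ?_
    refine (congrArg (φ.map c).hom (ha x)).trans ?_
    exact hc ⟨f.toMap x, (f.comm x).trans (congrArg f.base x.2)⟩

/-- The point `g ∘ f` of `Z ^ V`, for an `F`-map `g : Y → Z` and a point `f` of `Y ^ V`. -/
def FMap.postcomp {Y : FibreFamily φ B} {Z : FibreFamily φ B'} (g : FMap Y Z) {V : F}
    (f : FunctionSpace Y V) : FunctionSpace Z V :=
  FMap.comp g f

theorem FMap.continuous_postcomp {Y : FibreFamily φ B} {Z : FibreFamily φ B'} (g : FMap Y Z)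
    (V : F) : Continuous (g.postcomp : FunctionSpace Y V → FunctionSpace Z V) :=
  (FunctionSpace.isInducing Z V).continuous_iff.2
    ((ContinuousMap.continuous_postcomp g.toMap).comp (FunctionSpace.isInducing Y V).continuous)

theorem FunctionSpace.ext_of_forall {Y : FibreFamily φ B} {V : F} [Nonempty (φ.obj V)]
    {f f' : FunctionSpace Y V} (h : ∀ v, f.map v = f'.map v) : f = f' := by
  refine FunctionSpace.ext (ContinuousMap.ext h) ?_
  have v : φ.obj V := Classical.arbitrary _
  rw [← f.proj_map v, ← f'.proj_map v, h]

/-- A point of `Y ^ V` over a point of `U`, as a point of `(Y|U) ^ V`. -/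
def FunctionSpace.codRestrict {Y : FibreFamily φ B} {V : F} (U : Set B) (f : FunctionSpace Y V)
    (hf : f.pt ∈ U) : FunctionSpace (Y.restrict U) V where
  toMap := ⟨fun v : φ.obj V => ⟨f.map v, show Y.proj (f.map v) ∈ U by rwa [f.proj_map v]⟩,
    f.map.continuous.subtype_mk _⟩
  base := ContinuousMap.const _ ⟨f.pt, hf⟩
  comm := fun v => Subtype.ext (f.proj_map v)
  fibre := fun _ => by
    obtain ⟨g, hg⟩ := f.exists_hom rfl
    exact ⟨g, fun x => hg x.1⟩

theorem FunctionSpace.continuous_codRestrict (Y : FibreFamily φ B) (V : F) (U : Set B) :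
    Continuous fun f : {f : FunctionSpace Y V // f.pt ∈ U} => f.1.codRestrict U f.2 := by
  refine (FunctionSpace.isInducing _ V).continuous_iff.2 ?_
  refine (ContinuousMap.isInducing_postcomp (⟨Subtype.val, continuous_subtype_val⟩ :
    C((Y.restrict U).Total, Y.Total)) IsInducing.subtypeVal).continuous_iff.2 ?_
  exact (FunctionSpace.isInducing Y V).continuous.comp continuous_subtype_val

variable [φ.Faithful]

theorem FibreFamily.continuous_pt (Y : FibreFamily φ B) (V : F) [Nonempty (φ.obj V)] :
    Continuous (FunctionSpace.pt : FunctionSpace Y V → B) :=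
  (Y.functionFamily V).proj.continuous

theorem FibreFamily.functionFamily_chart_spec {Y : FibreFamily φ B} {V : F} [Nonempty (φ.obj V)]
    {b : B} (f : FunctionSpace Y V) (hf : f.pt = b) (v : φ.obj V) :
    (φ.map (show V ⟶ Y.fib b from (Y.functionFamily V).chart b ⟨f, hf⟩)).hom v =
      Y.chart b ⟨f.map v, (f.proj_map v).trans hf⟩ :=
  (f.exists_hom hf).choose_spec v

/-- The chart is defined by choosing a morphism. Faithfulness identifies any morphism with the right
underlying map with the chosen one, so charts can be computed without reference to the choice. -/
theorem FibreFamily.functionFamily_chart_eq {Y : FibreFamily φ B} {V : F} [Nonempty (φ.obj V)]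
    {b : B} (f : FunctionSpace Y V) (hf : f.pt = b) (g : V ⟶ Y.fib b)
    (h : ∀ v, (φ.map g).hom v = Y.chart b ⟨f.map v, (f.proj_map v).trans hf⟩) :
    (Y.functionFamily V).chart b ⟨f, hf⟩ = g := by
  refine φ.map_injective (TopCat.hom_ext (ContinuousMap.ext fun v => ?_))
  exact (functionFamily_chart_spec f hf v).trans (h v).symm

/-- The morphism `a` is prescribed instead of being extracted from `FMap.fibre`, so that an `a`
known to be invertible under `φ` can be used again in `isFibreIsoAt_characteristicMap`. -/
theorem FMap.functionMap_fibre {Y : FibreFamily φ B} {Z : FibreFamily φ B'} (k : FMap Y Z)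
    (V : F) [Nonempty (φ.obj V)] {b : B} {a : Y.fib b ⟶ Z.fib (k.base b)}
    (ha : ∀ x : (Y.proj ⁻¹' {b} : Set Y.Total), (φ.map a).hom (Y.chart b x) =
      Z.chart (k.base b) ⟨k.toMap x, (k.comm x).trans (congrArg k.base x.2)⟩)
    (f : FunctionSpace Y V) (hf : f.pt = b) :
    ((homFunctor φ V).map a).hom ((Y.functionFamily V).chart b ⟨f, hf⟩) =
      (Z.functionFamily V).chart (k.base b) ⟨k.postcomp f, congrArg k.base hf⟩ := by
  refine (FibreFamily.functionFamily_chart_eq _ _ _ fun v => ?_).symm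
  refine Eq.trans ?_ (ha ⟨f.map v, (f.proj_map v).trans hf⟩)
  refine (congrArg (fun c => (TopCat.Hom.hom c) v) (φ.map_comp _ a)).trans ?_
  exact congrArg (φ.map a).hom (FibreFamily.functionFamily_chart_spec f hf v)

/-- The `F`-map `Y ^ V → Z ^ V` induced by an `F`-map `Y → Z`. -/
noncomputable def FMap.functionMap {Y : FibreFamily φ B} {Z : FibreFamily φ B'} (k : FMap Y Z)
    (V : F) [Nonempty (φ.obj V)] : FMap (Y.functionFamily V) (Z.functionFamily V) where
  toMap := ⟨k.postcomp, k.continuous_postcomp V⟩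
  base := k.base
  comm := fun _ => rfl
  fibre := fun b => by
    obtain ⟨a, ha⟩ := k.fibre b
    exact ⟨a, fun f => k.functionMap_fibre V ha f.1 f.2⟩

/-- The canonical `F`-map `Y ^ V|U → (Y|U) ^ V`. -/
noncomputable def FibreFamily.restrictToFunction (Y : FibreFamily φ B) (V : F)
    [Nonempty (φ.obj V)] (U : Set B) :
    FMap ((Y.functionFamily V).restrict U) ((Y.restrict U).functionFamily V) where
  toMap := ⟨fun f => f.1.codRestrict U f.2, FunctionSpace.continuous_codRestrict Y V U⟩
  base := ContinuousMap.id _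
  comm := fun _ => rfl
  fibre := fun b => by
    refine ⟨𝟙 (Y.fib b.1), fun f => ?_⟩
    refine (congrArg (fun c => (TopCat.Hom.hom c) _) ((homFunctor φ V).map_id _)).trans ?_
    refine (functionFamily_chart_eq (f.1.1.codRestrict U f.1.2) f.2 _ fun v => ?_).symm
    exact functionFamily_chart_spec f.1.1 (congrArg Subtype.val f.2) v

/-- The canonical `F`-map `(Y|U) ^ V → Y ^ V|U`. -/
noncomputable def FibreFamily.functionToRestrict (Y : FibreFamily φ B) (V : F)
    [Nonempty (φ.obj V)] (U : Set B) :
    FMap ((Y.restrict U).functionFamily V) ((Y.functionFamily V).restrict U) where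
  toMap := ⟨fun f => ⟨(Y.restrictIncl U).postcomp f, (FunctionSpace.pt f).2⟩,
    ((Y.restrictIncl U).continuous_postcomp V).subtype_mk _⟩
  base := ContinuousMap.id _
  comm := fun _ => rfl
  fibre := fun b => by
    refine ⟨𝟙 (Y.fib b.1), fun f => ?_⟩
    refine (congrArg (fun c => (TopCat.Hom.hom c) _) ((homFunctor φ V).map_id _)).trans ?_
    refine (functionFamily_chart_eq f.1 f.2 _ fun v => ?_)
    exact functionFamily_chart_spec ((Y.restrictIncl U).postcomp f.1) (congrArg Subtype.val f.2) v

theorem FibreFamily.functionToRestrict_restrictToFunction (Y : FibreFamily φ B) (V : F)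
    [Nonempty (φ.obj V)] (U : Set B) (f : ((Y.functionFamily V).restrict U).Total) :
    (Y.functionToRestrict V U).toMap ((Y.restrictToFunction V U).toMap f) = f :=
  Subtype.ext (FunctionSpace.ext_of_forall fun _ => rfl)

theorem FibreFamily.restrictToFunction_functionToRestrict (Y : FibreFamily φ B) (V : F)
    [Nonempty (φ.obj V)] (U : Set B) (f : ((Y.restrict U).functionFamily V).Total) :
    (Y.restrictToFunction V U).toMap ((Y.functionToRestrict V U).toMap f) = f :=
  FunctionSpace.ext_of_forall fun _ => rfl

end Maps

/-! ### Isomorphisms -/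

section Isomorphisms

variable {B B' B'' : Type u} [TopologicalSpace B] [TopologicalSpace B'] [TopologicalSpace B'']

theorem FIsomorphic.trans {X : FibreFamily φ B} {Y : FibreFamily φ B'} {Z : FibreFamily φ B''}
    (h : FIsomorphic X Y) (h' : FIsomorphic Y Z) : FIsomorphic X Z := by
  obtain ⟨f, g, h1, h2, h3, h4⟩ := h
  obtain ⟨f', g', h1', h2', h3', h4'⟩ := h'
  refine ⟨f'.comp f, g.comp g', fun x => ?_, fun x => ?_, fun x => ?_, fun x => ?_⟩
  · exact (congrArg g.toMap (h1' _)).trans (h1 x)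
  · exact (congrArg f'.toMap (h2 _)).trans (h2' x)
  · exact (congrArg g.base (h3' _)).trans (h3 x)
  · exact (congrArg f'.base (h4 _)).trans (h4' x)

/-- The restriction of an `F`-map. -/
def FMap.restrict {X : FibreFamily φ B} {Y : FibreFamily φ B'} (f : FMap X Y) (U : Set B)
    (U' : Set B') (h : Set.MapsTo f.base U U') : FMap (X.restrict U) (Y.restrict U') where
  toMap := ⟨fun x => ⟨f.toMap x.1, show Y.proj (f.toMap x.1) ∈ U' by
    rw [f.comm]; exact h x.2⟩, by fun_prop⟩
  base := ⟨fun b => ⟨f.base b.1, h b.2⟩, by fun_prop⟩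
  comm := fun x => Subtype.ext (f.comm x.1)
  fibre := fun b => by
    obtain ⟨a, ha⟩ := f.fibre b.1
    exact ⟨a, fun x => ha ⟨x.1.1, congrArg Subtype.val x.2⟩⟩

/-- The maps are explicit because the restricted source lies over a preimage under `f.base`, which a
bare `FIsomorphic` does not name. -/
theorem FIsomorphic.restrict {X : FibreFamily φ B} {Y : FibreFamily φ B'} {f : FMap X Y}
    {g : FMap Y X} (h1 : ∀ x, g.toMap (f.toMap x) = x) (h2 : ∀ y, f.toMap (g.toMap y) = y)
    (h3 : ∀ b, g.base (f.base b) = b) (h4 : ∀ b', f.base (g.base b') = b') (U : Set B')  :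
    FIsomorphic (X.restrict (f.base ⁻¹' U)) (Y.restrict U) :=
  ⟨f.restrict _ U fun _ hb => hb,
    g.restrict U _ fun b hb => show f.base (g.base b) ∈ U by rwa [h4],
    fun _ => Subtype.ext (h1 _), fun _ => Subtype.ext (h2 _), fun _ => Subtype.ext (h3 _),
    fun _ => Subtype.ext (h4 _)⟩

/-- The `F`-map of product families with the same fibre which is induced by a map of the bases. -/
def productMap (φ : F ⥤ TopCat.{u}) (W : F) (θ : C(B, B')) :
    FMap (productFamily φ W B) (productFamily φ W B') where
  toMap := ⟨fun x : B × φ.obj W => ((θ x.1, x.2) : B' × φ.obj W),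
    Continuous.prodMk (θ.continuous.comp continuous_fst) continuous_snd⟩
  base := θ
  comm := fun _ => rfl
  fibre := fun b => ⟨𝟙 W, fun x => by
    exact congrArg (fun c => (TopCat.Hom.hom c) _) (φ.map_id W)⟩

theorem FIsomorphic.functionFamily [φ.Faithful] {X : FibreFamily φ B} {Y : FibreFamily φ B'}
    (h : FIsomorphic X Y) (V : F) [Nonempty (φ.obj V)] :
    FIsomorphic (X.functionFamily V) (Y.functionFamily V) := by
  obtain ⟨f, g, h1, h2, h3, h4⟩ := h
  exact ⟨f.functionMap V, g.functionMap V, fun _ => FunctionSpace.ext_of_forall fun _ => h1 _,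
    fun _ => FunctionSpace.ext_of_forall fun _ => h2 _, h3, h4⟩

theorem FibreFamily.fisomorphic_functionFamily_restrict [φ.Faithful] (X : FibreFamily φ B) (V : F)
    [Nonempty (φ.obj V)] (U : Set B) :
    FIsomorphic ((X.functionFamily V).restrict U) ((X.restrict U).functionFamily V) :=
  ⟨X.restrictToFunction V U, X.functionToRestrict V U,
    X.functionToRestrict_restrictToFunction V U, X.restrictToFunction_functionToRestrict V U,
    fun _ => rfl, fun _ => rfl⟩

/-- The point of `(B × φ W) ^ V` given by a point of `B` and a morphism `V ⟶ W`. -/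
def FunctionSpace.prodMk {V W : F} (b : B) (g : V ⟶ W) :
    FunctionSpace (productFamily φ W B) V :=
  FunctionSpace.ofHom (productFamily φ W B) V b g

theorem FunctionSpace.continuous_prodMk (V W : F) :
    Continuous fun p : B × HomSpace φ V W =>
      (FunctionSpace.prodMk p.1 p.2 : FunctionSpace (productFamily φ W B) V) := by
  refine (FunctionSpace.isInducing _ V).continuous_iff.2 ?_
  exact ContinuousMap.continuous_prodMk_const.comp (continuous_fst.prodMk
    ((HomSpace.isInducing φ V W).continuous.comp continuous_snd))

variable [φ.Faithful]

/-- An `F`-map into a product is a base point together with one morphism `V ⟶ W`. In one direction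
continuity is that of postcomposition with the second projection; in the other, that of pairing with
a constant map. -/
theorem productFamily_fisomorphic_functionFamily (V W : F) [Nonempty (φ.obj V)] :
    FIsomorphic ((productFamily φ W B).functionFamily V) (productFamily (homFunctor φ V) W B) := by
  have hc : ∀ (b : B) (f : FunctionSpace (productFamily φ W B) V) (hf : f.pt = b) (v : φ.obj V),
      (φ.map (show V ⟶ W from ((productFamily φ W B).functionFamily V).chart b ⟨f, hf⟩)).hom v =
        Prod.snd (α := B) (f.map v) := fun b f hf v =>
    FibreFamily.functionFamily_chart_spec f hf v
  let f : FMap ((productFamily φ W B).functionFamily V) (productFamily (homFunctor φ V) W B) :=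
    { toMap := ⟨fun f : FunctionSpace (productFamily φ W B) V =>
        ((f.pt, ((productFamily φ W B).functionFamily V).chart f.pt ⟨f, rfl⟩) :
          B × HomSpace φ V W), by
        refine (FibreFamily.continuous_pt _ V).prodMk
          ((HomSpace.isInducing φ V W).continuous_iff.2 ?_)
        refine ((ContinuousMap.continuous_postcomp
          (⟨Prod.snd, continuous_snd⟩ : C(B × φ.obj W, φ.obj W))).comp
            (FunctionSpace.isInducing _ V).continuous).congr fun f => ?_
        exact ContinuousMap.ext fun v => (hc _ f rfl v).symm⟩
      base := ContinuousMap.id _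
      comm := fun _ => rfl
      fibre := fun b => ⟨𝟙 W, by
        rintro ⟨f, rfl⟩
        exact congrArg (fun c => (TopCat.Hom.hom c) _) ((homFunctor φ V).map_id W)⟩ }
  let g : FMap (productFamily (homFunctor φ V) W B) ((productFamily φ W B).functionFamily V) :=
    { toMap := ⟨fun p : B × HomSpace φ V W => FunctionSpace.prodMk p.1 p.2,
        FunctionSpace.continuous_prodMk V W⟩
      base := ContinuousMap.id _
      comm := fun _ => rfl
      fibre := fun b => ⟨𝟙 W, by
        rintro ⟨⟨_, a⟩, rfl⟩
        refine (congrArg (fun c => (TopCat.Hom.hom c) _) ((homFunctor φ V).map_id W)).trans ?_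
        exact (FibreFamily.functionFamily_chart_eq (FunctionSpace.prodMk _ a) rfl _
          fun v => rfl).symm⟩ }
  refine ⟨f, g, fun x => FunctionSpace.ext_of_forall fun v => ?_, fun y => Prod.ext rfl ?_,
    fun _ => rfl, fun _ => rfl⟩
  · exact Prod.ext (FunctionSpace.proj_map x v).symm (hc _ x rfl v)
  · exact FibreFamily.functionFamily_chart_eq (FunctionSpace.prodMk y.1 y.2) rfl _ fun v => rfl

theorem FibreFamily.IsTrivial.functionFamily {X : FibreFamily φ B} (h : X.IsTrivial) (V : F)
    [Nonempty (φ.obj V)] : (X.functionFamily V).IsTrivial := by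
  obtain ⟨W, hW⟩ := h
  exact ⟨W, (hW.functionFamily V).trans (productFamily_fisomorphic_functionFamily V W)⟩

/-- The isomorphism may cover a non-identity homeomorphism of bases, so it leads to a product over
`B'`; `productMap` carries that product back to `B`. -/
theorem FibreFamily.IsTrivial.of_fisomorphic {ψ : F ⥤ TopCat.{u}} {X : FibreFamily ψ B}
    {Y : FibreFamily ψ B'} (hY : Y.IsTrivial) (h : FIsomorphic X Y) : X.IsTrivial := by
  obtain ⟨W, hW⟩ := hY
  refine ⟨W, (h.trans hW).trans ?_⟩
  obtain ⟨f, g, -, -, h3, h4⟩ := h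
  exact ⟨productMap ψ W g.base, productMap ψ W f.base, fun x => Prod.ext (h4 _) rfl,
    fun x => Prod.ext (h3 _) rfl, h4, h3⟩

theorem FibreFamily.IsBundle.of_fisomorphic {ψ : F ⥤ TopCat.{u}} {X : FibreFamily ψ B}
    {Y : FibreFamily ψ B'} (hY : Y.IsBundle) (h : FIsomorphic X Y) : X.IsBundle := by
  obtain ⟨f, g, h1, h2, h3, h4⟩ := h
  intro b
  obtain ⟨U, hU, hU'⟩ := hY (f.base b)
  exact ⟨f.base ⁻¹' U, f.base.continuous.continuousAt hU,
    hU'.of_fisomorphic (FIsomorphic.restrict h1 h2 h3 h4 U)⟩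

theorem FibreFamily.IsBundle.functionFamily {X : FibreFamily φ B} (h : X.IsBundle) (V : F)
    [Nonempty (φ.obj V)] : (X.functionFamily V).IsBundle := by
  intro b
  obtain ⟨U, hU, hU'⟩ := h b
  exact ⟨U, hU, (hU'.functionFamily V).of_fisomorphic
    (X.fisomorphic_functionFamily_restrict V U)⟩

end Isomorphisms

end

section

variable {F : Type u} [SmallCategory F] {φ : F ⥤ TopCat.{u}}

/-! ### Generating families and spaces of morphisms -/

/-- A non-empty compact subset `K` of `φ V` such that the sets `N_{K,C}` in the spaces `hom(V, W)`
are compact for all compact `C`. -/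
structure IsProperTest (φ : F ⥤ TopCat.{u}) (V : F) (K : Set (φ.obj V)) : Prop where
  isCompact : IsCompact K
  nonempty : K.Nonempty
  isCompact_hom : ∀ (W : F) (C : Set (φ.obj W)), IsCompact C →
    IsCompact {g : HomSpace φ V W | Set.MapsTo (φ.map (show V ⟶ W from g)).hom K C}

/-- If all members were empty, every subbasic set would be the whole space and `Y ^ V` would be
indiscrete for every `Y`. Over a two-point discrete base this contradicts the continuity of the
projection, since both points of the base are hit. -/
theorem IsGenerating.exists_nonempty [φ.Faithful] {V : F} [Nonempty (φ.obj V)]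
    {𝒦 : Set (Set (φ.obj V))} (h : IsGenerating φ V 𝒦) : ∃ K ∈ 𝒦, K.Nonempty := by
  by_contra! hne
  let Y := productFamily φ V (ULift.{u} Bool)
  have htop : (inferInstance : TopologicalSpace (FunctionSpace Y V)) = ⊤ := by
    refine (h.subbasis _ Y).trans (top_le_iff.1 (le_generateFrom ?_))
    rintro _ ⟨K, hK, U, -, rfl⟩
    rw [hne K hK]
    have : FunctionSpace.N Y V ∅ U = Set.univ := Set.eq_univ_of_forall fun f => Set.mapsTo_empty _ _
    rw [this]
    exact @isOpen_univ _ ⊤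
  have ho : IsOpen ((FunctionSpace.pt : FunctionSpace Y V → ULift.{u} Bool) ⁻¹' {⟨true⟩}) :=
    (isOpen_discrete _).preimage (Y.continuous_pt V)
  have ho' : @IsOpen _ ⊤
      ((FunctionSpace.pt : FunctionSpace Y V → ULift.{u} Bool) ⁻¹' {⟨true⟩}) := by
    rw [← htop]; exact ho
  rcases (TopologicalSpace.isOpen_top_iff _).1 ho' with h' | h'
  · exact (h'.subset (show FunctionSpace.prodMk ⟨true⟩ (𝟙 V) ∈ _ from rfl) : False)
  · have : FunctionSpace.prodMk (φ := φ) (B := ULift.{u} Bool) ⟨false⟩ (𝟙 V) ∈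
      (FunctionSpace.pt : FunctionSpace Y V → ULift.{u} Bool) ⁻¹' {⟨true⟩} := h' ▸ Set.mem_univ _
    have h2 : (⟨false⟩ : ULift.{u} Bool) = ⟨true⟩ := this
    simp at h2

theorem IsNKC.exists_isProperTest [φ.Faithful] (hφ : IsNKC φ) (V : F) [Nonempty (φ.obj V)] :
    ∃ 𝒦 : Set (Set (φ.obj V)), IsGenerating φ V 𝒦 ∧ ∃ K ∈ 𝒦, IsProperTest φ V K := by
  obtain ⟨𝒦, h𝒦, h⟩ := hφ.exists_generating V
  obtain ⟨K, hK, hne⟩ := h𝒦.exists_nonempty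
  exact ⟨𝒦, h𝒦, K, hK, h𝒦.isCompact K hK, hne, h K hK⟩

/-- Finite intersections of sets `N_{K,U}` with `K` in a generating family form a basis of the
topology; one may always use a given member `K₀` of the family. -/
theorem IsGenerating.exists_basic {V : F} {𝒦 : Set (Set (φ.obj V))} (h : IsGenerating φ V 𝒦)
    {K₀ : Set (φ.obj V)} (hK₀ : K₀ ∈ 𝒦) {B : Type u} [TopologicalSpace B] (Y : FibreFamily φ B)
    {U : Set (FunctionSpace Y V)} (hU : IsOpen U) {f : FunctionSpace Y V} (hf : f ∈ U) :
    ∃ (J : Type u) (_ : Finite J) (K : J → Set (φ.obj V)) (O : J → Set Y.Total),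
      (∀ j, K j ∈ 𝒦) ∧ (∃ j, K j = K₀) ∧ (∀ j, IsOpen (O j)) ∧
      (∀ j, Set.MapsTo f.map (K j) (O j)) ∧
      ∀ g : FunctionSpace Y V, (∀ j, Set.MapsTo g.map (K j) (O j)) → g ∈ U := by
  have hb := TopologicalSpace.isTopologicalBasis_of_subbasis (h.subbasis B Y)
  obtain ⟨_, ⟨t, ⟨htf, ht⟩, rfl⟩, hft, htU⟩ := hb.exists_subset_of_mem_open hf hU
  have ht' : ∀ s ∈ t, ∃ K ∈ 𝒦, ∃ O : Set Y.Total, IsOpen O ∧ s = FunctionSpace.N Y V K O :=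
    fun s hs => ht hs
  choose! K hK O hO hKO using ht'
  -- The additional index `none` carries `K₀` with the whole total space as target: it imposes no
  -- condition but makes `K₀` available for compactness arguments.
  refine ⟨Option t, ?_, fun j => j.elim K₀ fun s => K s.1, fun j => j.elim Set.univ fun s => O s.1,
    ?_, ⟨none, rfl⟩, ?_, ?_, ?_⟩
  · have := htf.to_subtype
    infer_instance
  · rintro (_ | s)
    exacts [hK₀, hK s.1 s.2]
  · rintro (_ | s)
    exacts [isOpen_univ, hO s.1 s.2]
  · rintro (_ | s)
    · exact Set.mapsTo_univ _ _
    · have := hft s.1 s.2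
      rw [hKO s.1 s.2] at this
      exact this
  · intro g hg
    refine htU fun s hs => ?_
    rw [hKO s hs]
    exact hg (some ⟨s, hs⟩)

/-- By faithfulness `hom(V, W)` embeds in `C(φ V, φ W)`, which is Hausdorff and second countable. A
compact neighbourhood of `g` is `N_{K,C}`, where `C` is compact and contains `g(K)` in its interior.
-/
theorem IsNKC.isFibreFunctor_homFunctor [φ.Faithful] (hφ : IsNKC φ) (V : F)
    [Nonempty (φ.obj V)] : IsFibreFunctor (homFunctor φ V) := by
  have hlc := hφ.isFibreFunctor.locallyCompact
  have hsc := hφ.isFibreFunctor.secondCountable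
  have ht2 := hφ.isFibreFunctor.t2
  have hinj : ∀ W, Function.Injective (fun g : HomSpace φ V W =>
      ((φ.map (show V ⟶ W from g)).hom : C(φ.obj V, φ.obj W))) := fun W g g' h =>
    φ.map_injective (TopCat.hom_ext h)
  have ht : ∀ W : F, T2Space (HomSpace φ V W) := fun W =>
    (IsEmbedding.mk (HomSpace.isInducing φ V W) (hinj W)).t2Space
  refine ⟨fun W => ?_, fun W => ?_, ht⟩
  · obtain ⟨𝒦, -, K, hK, hKp⟩ := hφ.exists_isProperTest V
    have : WeaklyLocallyCompactSpace (HomSpace φ V W) := ⟨fun g => by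
      obtain ⟨C, hC, hgC⟩ := exists_compact_superset
        (hKp.isCompact.image ((φ.map (show V ⟶ W from g)).hom : C(φ.obj V, φ.obj W)).continuous)
      have ho : IsOpen {f : C(φ.obj V, φ.obj W) | Set.MapsTo f K (interior C)} :=
        ContinuousMap.isOpen_setOfPred_mapsTo hKp.isCompact isOpen_interior
      refine ⟨_, hKp.isCompact_hom W C hC, Filter.mem_of_superset
        ((ho.preimage (HomSpace.isInducing φ V W).continuous).mem_nhds
          (Set.mapsTo_iff_image_subset.2 hgC)) fun g' hg' => ?_⟩
      exact Set.MapsTo.mono_right hg' interior_subset⟩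
    have := ht W
    exact (inferInstance : LocallyCompactSpace (HomSpace φ V W))
  · exact (HomSpace.isInducing φ V W).secondCountableTopology

/-! ### Trivializations -/

section Bundles

variable {B : Type u} [TopologicalSpace B]

/-- A trivialization of `X` over an open set `U` with fibre `φ W`, consisting of mutually inverse
`F`-maps over the identity of `U`. -/
structure Triv (X : FibreFamily φ B) (U : Set B) (W : F) where
  isOpen : IsOpen U
  fwd : FMap (X.restrict U) (productFamily φ W U)
  inv : FMap (productFamily φ W U) (X.restrict U)
  inv_fwd : ∀ x, inv.toMap (fwd.toMap x) = x
  fwd_inv : ∀ x, fwd.toMap (inv.toMap x) = x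
  fwd_base : ∀ b, fwd.base b = b
  inv_base : ∀ b, inv.base b = b

/-- The bundle condition allows an arbitrary neighbourhood and an isomorphism covering an arbitrary
homeomorphism. Shrinking to the interior and undoing the base map on the product factor gives an
isomorphism over the identity of an open set. -/
theorem FibreFamily.IsBundle.exists_triv {X : FibreFamily φ B} (hX : X.IsBundle) (b : B) :
    ∃ (U : Set B) (W : F), b ∈ U ∧ Nonempty (Triv X U W) := by
  obtain ⟨U, hU, W, f, g, h1, h2, h3, h4⟩ := hX b
  have hi : interior U ⊆ U := interior_subset
  let θ : C(interior U, U) := ⟨Set.inclusion hi, continuous_inclusion hi⟩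
  let f' := (productMap φ W g.base).comp (f.comp (X.restrictLE hi))
  have hf' : ∀ b, f'.base b = θ b := fun b => h3 _
  let g' := g.comp ((productMap φ W f.base).comp (productMap φ W θ))
  have hg' : ∀ b, g'.base b = θ b := fun b => h3 _
  have e : ∀ x, X.proj (g'.toMap x).1 = x.1.1 := fun x =>
    congrArg Subtype.val ((g'.comm x).trans (hg' x.1))
  have e' : ∀ x, (f'.toMap x).1.1 = X.proj x.1 := fun x =>
    congrArg Subtype.val ((f'.comm x).trans (hf' _))
  refine ⟨interior U, W, mem_interior_iff_mem_nhds.2 hU, ⟨⟨isOpen_interior,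
    ⟨⟨fun x => ((⟨X.proj x.1, x.2⟩, (f'.toMap x).2) : interior U × φ.obj W), ?_⟩,
      ContinuousMap.id _, fun _ => rfl, ?_⟩,
    ⟨⟨fun x => ⟨(g'.toMap x).1, ?_⟩, ?_⟩, ContinuousMap.id _, fun x => Subtype.ext (e x), ?_⟩,
    ?_, ?_, fun _ => rfl, fun _ => rfl⟩⟩⟩
  · exact Continuous.prodMk (by fun_prop) (continuous_snd.comp f'.toMap.continuous)
  · intro b
    obtain ⟨a, ha⟩ := f'.fibre b
    exact ⟨a, fun x => ha x⟩
  · change X.proj _ ∈ interior U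
    rw [e x]; exact x.1.2
  · exact (continuous_subtype_val.comp g'.toMap.continuous).subtype_mk _
  · intro b
    have hgb := g'.fibre b
    -- The equality `g'.base b = θ b` is only propositional, while the chart depends on the base
    -- point; generalizing to `c` makes it possible to substitute.
    have : ∀ c : U, g'.base b = c → c = θ b → ∃ a : W ⟶ X.fib c.1,
        ∀ x : ((productFamily φ W (interior U)).proj ⁻¹' {b} : Set _),
        ∀ h : X.proj (g'.toMap x.1).1 = c.1,
      (φ.map a).hom ((productFamily φ W (interior U)).chart b x) =
        X.chart c.1 ⟨(g'.toMap x.1).1, h⟩ := by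
      rintro _ rfl -
      obtain ⟨a, ha⟩ := hgb
      exact ⟨a, fun x h => ha x⟩
    obtain ⟨a, ha⟩ := this (θ b) (hg' b) rfl
    exact ⟨a, fun x => ha x ((e x.1).trans (congrArg Subtype.val x.2))⟩
  · intro x
    refine Subtype.ext ?_
    refine (congrArg (fun z => (g.toMap z).1) (?_ : _ = f.toMap ⟨x.1, hi x.2⟩)).trans
      (congrArg Subtype.val (h1 ⟨x.1, hi x.2⟩))
    exact Prod.ext (f.comm ⟨x.1, hi x.2⟩).symm rfl
  · intro x
    refine Prod.ext (Subtype.ext (e x)) ?_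
    have := h2 ((f.base (θ x.1), x.2) : U × φ.obj W)
    exact (congrArg (fun z : U × φ.obj W => z.2) this :)

namespace Triv

variable {X : FibreFamily φ B} {U : Set B} {W : F} (t : Triv X U W)

/-- The homeomorphism underlying a trivialization. -/
def homeo : (X.proj ⁻¹' U : Set X.Total) ≃ₜ U × φ.obj W where
  toFun := t.fwd.toMap
  invFun := t.inv.toMap
  left_inv := t.inv_fwd
  right_inv := t.fwd_inv
  continuous_toFun := t.fwd.toMap.continuous
  continuous_invFun := t.inv.toMap.continuous

theorem homeo_fst (x : (X.proj ⁻¹' U : Set X.Total)) : (t.homeo x).1.1 = X.proj x :=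
  congrArg Subtype.val ((t.fwd.comm x).trans (t.fwd_base _))

theorem proj_homeo_symm (p : U × φ.obj W) : X.proj (t.homeo.symm p).1 = p.1 := by
  rw [← t.homeo_fst, Homeomorph.apply_symm_apply]

theorem isOpen_preimage (t : Triv X U W) : IsOpen (X.proj ⁻¹' U : Set X.Total) :=
  t.isOpen.preimage X.proj.continuous

/-- The map `(U × hom(V, W)) → X ^ V` given by a trivialization. -/
def ofHom {V : F} (p : U × HomSpace φ V W) : FunctionSpace X V :=
  (X.restrictIncl U).postcomp (t.inv.postcomp (FunctionSpace.prodMk p.1 p.2))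

theorem continuous_ofHom (V : F) : Continuous (t.ofHom : U × HomSpace φ V W → _) :=
  ((X.restrictIncl U).continuous_postcomp V).comp ((t.inv.continuous_postcomp V).comp
    (FunctionSpace.continuous_prodMk V W))

theorem ofHom_map {V : F} (p : U × HomSpace φ V W) (v : φ.obj V) : (t.ofHom p).map v =
    (t.homeo.symm (p.1, (φ.map (show V ⟶ W from p.2)).hom v)).1 := rfl

theorem exists_eq_ofHom {V : F} [Nonempty (φ.obj V)] (f : FunctionSpace X V) (hf : f.pt ∈ U) :
    ∃ g : HomSpace φ V W, f = t.ofHom (⟨f.pt, hf⟩, g) := by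
  let f' : FunctionSpace (productFamily φ W U) V := t.fwd.postcomp (f.codRestrict U hf)
  have hpt : f'.pt = ⟨f.pt, hf⟩ := t.fwd_base _
  obtain ⟨g, hg⟩ := f'.exists_hom hpt
  refine ⟨g, FunctionSpace.ext_of_forall fun v => ?_⟩
  have hv : f'.map v = (((⟨f.pt, hf⟩ : U), (φ.map g).hom v) : U × φ.obj W) :=
    Prod.ext ((f'.proj_map v).trans hpt) (hg v).symm
  rw [ofHom_map]
  refine Eq.trans ?_ (congrArg (fun z => (t.homeo.symm z).1) hv)
  exact (congrArg Subtype.val (t.homeo.symm_apply_apply ((f.codRestrict U hf).map v))).symm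

end Triv

end Bundles

end

section

variable {F : Type u} [SmallCategory F] {φ : F ⥤ TopCat.{u}} {B : Type u} [TopologicalSpace B]
  {X : FibreFamily φ B}

/-! ### Topology of bundles -/

/-- Points of one fibre are separated inside a common trivialization, points of different fibres by
the base. -/
theorem FibreFamily.IsBundle.t2Space (hX : X.IsBundle) (hφ : IsFibreFunctor φ) [T2Space B] :
    T2Space X.Total := by
  refine ⟨fun x y hxy => ?_⟩
  by_cases h : X.proj x = X.proj y
  · obtain ⟨U, W, hU, ⟨t⟩⟩ := hX.exists_triv (X.proj x)
    have := hφ.t2 W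
    have := t.homeo.symm.t2Space
    have hU' : X.proj y ∈ U := h ▸ hU
    have hne : (⟨x, hU⟩ : (X.proj ⁻¹' U : Set X.Total)) ≠ ⟨y, hU'⟩ := fun e =>
      hxy (congrArg Subtype.val e)
    exact separated_by_isOpenEmbedding t.isOpen_preimage.isOpenEmbedding_subtypeVal hne
  · exact separated_by_continuous X.proj.continuous h

theorem FibreFamily.IsBundle.weaklyLocallyCompactSpace (hX : X.IsBundle)
    (hφ : IsFibreFunctor φ) [LocallyCompactSpace B] : WeaklyLocallyCompactSpace X.Total := by
  refine ⟨fun x => ?_⟩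
  obtain ⟨U, W, hU, ⟨t⟩⟩ := hX.exists_triv (X.proj x)
  have := hφ.locallyCompact W
  have := t.isOpen.locallyCompactSpace
  have := t.homeo.isClosedEmbedding.locallyCompactSpace
  obtain ⟨s, hs, hxs⟩ := exists_compact_mem_nhds (⟨x, hU⟩ : (X.proj ⁻¹' U : Set X.Total))
  exact ⟨Subtype.val '' s, hs.image continuous_subtype_val,
    t.isOpen_preimage.isOpenEmbedding_subtypeVal.image_mem_nhds.2 hxs⟩

theorem FibreFamily.IsBundle.secondCountableTopology (hX : X.IsBundle)
    (hφ : IsFibreFunctor φ) [SecondCountableTopology B] : SecondCountableTopology X.Total := by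
  choose U W hU t using hX.exists_triv
  obtain ⟨s, hs, hsU⟩ := TopologicalSpace.countable_cover_nhds fun b =>
    (t b).some.isOpen.mem_nhds (hU b)
  have := hs.to_subtype
  have (b : s) : SecondCountableTopology (X.proj ⁻¹' U b : Set X.Total) := by
    have := hφ.secondCountable (W b)
    exact (t b).some.homeo.isInducing.secondCountableTopology
  refine TopologicalSpace.secondCountableTopology_of_countable_cover
    (U := fun b : s => (X.proj ⁻¹' U b : Set X.Total)) (fun b => (t b).some.isOpen_preimage) ?_
  rw [← Set.preimage_iUnion, ← Set.biUnion_eq_iUnion s (fun b _ => U b), hsU, Set.preimage_univ]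

theorem FunctionSpace.isClosed_mapsTo {V : F} (K : Set (φ.obj V)) {L : Set X.Total}
    (hL : IsClosed L) : IsClosed {f : FunctionSpace X V | Set.MapsTo f.map K L} :=
  (ContinuousMap.isClosed_setOfPred_mapsTo hL K).preimage (FunctionSpace.isInducing X V).continuous

theorem FunctionSpace.isOpen_mapsTo {V : F} {K : Set (φ.obj V)} (hK : IsCompact K)
    {U : Set X.Total} (hU : IsOpen U) : IsOpen {f : FunctionSpace X V | Set.MapsTo f.map K U} :=
  (ContinuousMap.isOpen_setOfPred_mapsTo hK hU).preimage (FunctionSpace.isInducing X V).continuous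

/-- In a bundle over a regular Hausdorff space, the sets `N_{K,L}` are compact for compact `L`. -/
theorem IsProperTest.isCompact_mapsTo [φ.Faithful] {V : F} {K : Set (φ.obj V)}
    (hK : IsProperTest φ V K) (hφ : IsFibreFunctor φ) (hX : X.IsBundle) [T3Space B]
    {L : Set X.Total} (hL : IsCompact L) :
    IsCompact {f : FunctionSpace X V | Set.MapsTo f.map K L} := by
  obtain ⟨v, hv⟩ := hK.nonempty
  have : Nonempty (φ.obj V) := ⟨v⟩
  have := hX.t2Space hφ
  -- The set in question is closed, so it only has to be enclosed in a compact set. As `K` is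
  -- non-empty, its members lie over the compact set `X.proj '' L`, and finitely many local
  -- enclosures are enough.
  suffices h : ∃ H : Set (FunctionSpace X V), IsCompact H ∧
      ∀ f : FunctionSpace X V, Set.MapsTo f.map K L → f.pt ∈ X.proj '' L → f ∈ H by
    obtain ⟨H, hH, hLH⟩ := h
    refine hH.of_isClosed_subset (FunctionSpace.isClosed_mapsTo K hL.isClosed) fun f hf => ?_
    exact hLH f hf ⟨f.map v, hf hv, f.proj_map v⟩
  refine (hL.image X.proj.continuous).induction_on
    (p := fun s => ∃ H : Set (FunctionSpace X V), IsCompact H ∧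
      ∀ f : FunctionSpace X V, Set.MapsTo f.map K L → f.pt ∈ s → f ∈ H)
    ⟨∅, isCompact_empty, fun f _ h => h⟩ ?_ ?_ ?_
  · rintro s t hst ⟨H, hH, h⟩
    exact ⟨H, hH, fun f hf hs => h f hf (hst hs)⟩
  · rintro s t ⟨H, hH, h⟩ ⟨H', hH', h'⟩
    exact ⟨H ∪ H', hH.union hH', fun f hf => Or.imp (h f hf) (h' f hf)⟩
  · intro b _
    obtain ⟨U, W, hU, ⟨t⟩⟩ := hX.exists_triv b
    -- A closed neighbourhood `D` inside `U` keeps the part of `L` over `D` compact in `U × φ W`. An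
    -- `F`-map over `D` sending `K` to `L` is then a pair in the product of the first projection of
    -- this part with `N_{K,C}`, for `C` its second projection; the latter is compact by
    -- `IsProperTest`.
    obtain ⟨D, hD, hDc, hDU⟩ := exists_mem_nhds_isClosed_subset (t.isOpen.mem_nhds hU)
    refine ⟨D, mem_nhdsWithin_of_mem_nhds hD, ?_⟩
    let L' : Set (X.proj ⁻¹' U : Set X.Total) := Subtype.val ⁻¹' (L ∩ X.proj ⁻¹' D)
    have hL' : IsCompact L' := by
      refine IsInducing.subtypeVal.isCompact_preimage_iff ?_ |>.2
        (hL.inter_right (hDc.preimage X.proj.continuous))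
      rw [Subtype.range_coe]
      exact fun x hx => hDU hx.2
    have hC := hL'.image t.homeo.continuous
    refine ⟨_, ((hC.image continuous_fst).prod
      (hK.isCompact_hom W _ (hC.image continuous_snd))).image (t.continuous_ofHom V), ?_⟩
    intro f hf hfD
    obtain ⟨g, hg⟩ := t.exists_eq_ofHom f (hDU hfD)
    have key : ∀ w ∈ K, ∃ x ∈ L', t.homeo x =
        (⟨f.pt, hDU hfD⟩, (φ.map (show V ⟶ W from g)).hom w) := by
      intro w hw
      refine ⟨t.homeo.symm (⟨f.pt, hDU hfD⟩, (φ.map (show V ⟶ W from g)).hom w), ⟨?_, ?_⟩,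
        t.homeo.apply_symm_apply _⟩
      · rw [← t.ofHom_map (⟨f.pt, hDU hfD⟩, g), ← hg]
        exact hf hw
      · rw [Set.mem_preimage, t.proj_homeo_symm]
        exact hfD
    refine ⟨(⟨f.pt, hDU hfD⟩, g), ⟨?_, fun w hw => ?_⟩, hg.symm⟩
    · obtain ⟨x, hx, hxe⟩ := key v hv
      exact ⟨_, ⟨x, hx, rfl⟩, congrArg Prod.fst hxe⟩
    · obtain ⟨x, hx, hxe⟩ := key w hw
      exact ⟨_, ⟨x, hx, rfl⟩, congrArg Prod.snd hxe⟩

/-- A compact Hausdorff space which is the image of a second countable space is second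
countable. -/
theorem secondCountableTopology_of_isClosedMap {Y Z : Type*} [TopologicalSpace Y]
    [TopologicalSpace Z] [CompactSpace Y] [SecondCountableTopology Y] [T2Space Z] (f : Y → Z)
    (hf : Continuous f) (hs : Function.Surjective f) : SecondCountableTopology Z := by
  have hcl : IsClosedMap f := hf.isClosedMap
  let b := TopologicalSpace.countableBasis Y
  -- Each member is the set of points whose whole fibre lies in a finite union of basic open sets.
  -- It is open because `f` is closed, and these sets form a basis because fibres are compact.
  let c : Set (Set Z) := (fun s : Set (Set Y) => (f '' (⋃₀ s)ᶜ)ᶜ) '' {s | s.Finite ∧ s ⊆ b}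
  have hc : c.Countable :=
    (Set.countable_ofPred_finite_subset (TopologicalSpace.countable_countableBasis Y)).image _
  refine (TopologicalSpace.isTopologicalBasis_of_isOpen_of_nhds (s := c) ?_ ?_
    ).secondCountableTopology hc
  · rintro _ ⟨s, ⟨-, hs⟩, rfl⟩
    exact (hcl _ (isOpen_sUnion fun t ht =>
      TopologicalSpace.isOpen_of_mem_countableBasis (hs ht)).isClosed_compl).isOpen_compl
  · intro z U hz hU
    have hK : IsCompact (f ⁻¹' {z}) := (isClosed_singleton.preimage hf).isCompact
    have hKU : f ⁻¹' {z} ⊆ f ⁻¹' U := Set.preimage_mono (Set.singleton_subset_iff.2 hz)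
    obtain ⟨s, hsb, hsf, hKs, hsU⟩ : ∃ s ⊆ b, s.Finite ∧ f ⁻¹' {z} ⊆ ⋃₀ s ∧ ⋃₀ s ⊆ f ⁻¹' U := by
      refine hK.induction_on
        (p := fun K => ∃ s ⊆ b, s.Finite ∧ K ⊆ ⋃₀ s ∧ ⋃₀ s ⊆ f ⁻¹' U)
        ⟨∅, by simp⟩ ?_ ?_ ?_
      · rintro K K' h ⟨s, h1, h2, h3, h4⟩
        exact ⟨s, h1, h2, h.trans h3, h4⟩
      · rintro K K' ⟨s, h1, h2, h3, h4⟩ ⟨s', h1', h2', h3', h4'⟩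
        refine ⟨s ∪ s', Set.union_subset h1 h1', h2.union h2', ?_, ?_⟩
        · rw [Set.sUnion_union]
          exact Set.union_subset_union h3 h3'
        · rw [Set.sUnion_union]
          exact Set.union_subset h4 h4'
      · intro y hy
        obtain ⟨t, ht, hyt, htU⟩ :=
          (TopologicalSpace.isBasis_countableBasis Y).exists_subset_of_mem_open (hKU hy) (hU.preimage hf)
        exact ⟨t, mem_nhdsWithin_of_mem_nhds
          ((TopologicalSpace.isOpen_of_mem_countableBasis ht).mem_nhds hyt),
          {t}, by simpa using ht, Set.finite_singleton _, by simp, by simpa using htU⟩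
    refine ⟨_, ⟨s, ⟨hsf, hsb⟩, rfl⟩, ?_, ?_⟩
    · rintro ⟨y, hy, rfl⟩
      exact hy (hKs rfl)
    · intro z' hz'
      obtain ⟨y, rfl⟩ := hs z'
      by_contra hyU
      exact hz' ⟨y, fun hy => hyU (hsU hy), rfl⟩

end

section

variable {F : Type u} [SmallCategory F] {φ : F ⥤ TopCat.{u}} [φ.Faithful]
  {B : Type u} [TopologicalSpace B] {X : FibreFamily φ B}

/-! ### Extension of open sets from a closed part of the base -/

/-- One step of the extension: compact sets `M j` none of whose `N`-intersections meets the closed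
set `E` have compact neighbourhoods with the same property inside given open sets. -/
theorem exists_compact_nhds_extension (hφ : IsFibreFunctor φ) (hX : X.IsBundle) [CompactSpace B]
    [T2Space B] {V : F} {J : Type*} [Finite J] {K : J → Set (φ.obj V)} {j₀ : J}
    (hK₀ : IsProperTest φ V (K j₀)) {E : Set (FunctionSpace X V)} (hE : IsClosed E)
    {M Ω : J → Set X.Total} (hM : ∀ j, IsCompact (M j)) (hΩ : ∀ j, IsOpen (Ω j))
    (hMΩ : ∀ j, M j ⊆ Ω j) (hME : ∀ f ∈ E, ¬ ∀ j, Set.MapsTo f.map (K j) (M j)) :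
    ∃ Q : J → Set X.Total, (∀ j, IsCompact (Q j)) ∧ (∀ j, M j ⊆ interior (Q j)) ∧
      (∀ j, Q j ⊆ Ω j) ∧ ∀ f ∈ E, ¬ ∀ j, Set.MapsTo f.map (K j) (Q j) := by
  have := hX.t2Space hφ
  have := hX.weaklyLocallyCompactSpace hφ
  by_contra! hcon
  -- If no choice works, every admissible `Q` leaves a non-empty set `T Q` of bad maps. This set is
  -- closed in the compact set `N_{K j₀, Q j₀}`, and intersecting neighbourhoods makes the family
  -- directed, so some `f` is bad for all `Q` at once. Shrinking `Q` to `M` then makes `f` bad for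
  -- `M`.
  let I := {Q : J → Set X.Total // (∀ j, IsCompact (Q j)) ∧ (∀ j, M j ⊆ interior (Q j)) ∧
    ∀ j, Q j ⊆ Ω j}
  let T : I → Set (FunctionSpace X V) := fun Q => E ∩ ⋂ j, {f | Set.MapsTo f.map (K j) (Q.1 j)}
  have hTcl : ∀ Q, IsClosed (T Q) := fun Q => hE.inter (isClosed_iInter fun j =>
    FunctionSpace.isClosed_mapsTo _ (Q.2.1 j).isClosed)
  have hTc : ∀ Q, IsCompact (T Q) := fun Q =>
    (hK₀.isCompact_mapsTo hφ hX (Q.2.1 j₀)).of_isClosed_subset (hTcl Q) fun f hf =>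
      Set.mem_iInter.1 hf.2 j₀
  have hTne : ∀ Q, (T Q).Nonempty := fun Q => by
    obtain ⟨f, hf, hf'⟩ := hcon Q.1 Q.2.1 Q.2.2.1 Q.2.2.2
    exact ⟨f, hf, Set.mem_iInter.2 hf'⟩
  have hdir : Directed (· ⊇ ·) T := by
    intro Q Q'
    refine ⟨⟨fun j => Q.1 j ∩ Q'.1 j, fun j => (Q.2.1 j).inter (Q'.2.1 j), fun j => ?_,
      fun j => Set.inter_subset_left.trans (Q.2.2.2 j)⟩, ?_, ?_⟩
    · rw [interior_inter]
      exact Set.subset_inter (Q.2.2.1 j) (Q'.2.2.1 j)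
    · exact fun f hf => ⟨hf.1, Set.mem_iInter.2 fun j =>
        (Set.mem_iInter.1 hf.2 j).mono_right Set.inter_subset_left⟩
    · exact fun f hf => ⟨hf.1, Set.mem_iInter.2 fun j =>
        (Set.mem_iInter.1 hf.2 j).mono_right Set.inter_subset_right⟩
  have hnb : ∀ O : J → Set X.Total, (∀ j, IsOpen (O j)) → (∀ j, M j ⊆ O j) → (∀ j, O j ⊆ Ω j) →
      ∃ Q : I, ∀ j, Q.1 j ⊆ O j := fun O hO hMO hOΩ => by
    choose Q hQ hMQ hQO using fun j => exists_compact_between (hM j) (hO j) (hMO j)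
    exact ⟨⟨Q, hQ, hMQ, fun j => (hQO j).trans (hOΩ j)⟩, hQO⟩
  have hne : Nonempty I := ⟨(hnb Ω hΩ hMΩ fun _ => subset_rfl).choose⟩
  obtain ⟨f, hf⟩ := IsCompact.nonempty_iInter_of_directed_nonempty_isCompact_isClosed T hdir hTne
    hTc hTcl
  rw [Set.mem_iInter] at hf
  refine hME f (hf hne.some).1 fun j v hv => ?_
  by_contra hvM
  classical
  -- The point `f.map v` is removed at every index where it is outside `M`, in particular at the
  -- given one; at the other indices removing it would destroy the inclusion of `M`.
  obtain ⟨Q, hQ⟩ := hnb (fun j => Ω j ∩ if f.map v ∈ M j then Set.univ else {f.map v}ᶜ)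
    (fun j => (hΩ j).inter (by split_ifs; exacts [isOpen_univ, isOpen_compl_singleton]))
    (fun j => Set.subset_inter (hMΩ j) (by
      split_ifs with h
      · exact Set.subset_univ _
      · exact fun x hx hxe => h (hxe ▸ hx)))
    fun j => Set.inter_subset_left
  have h1 := (hQ j (Set.mem_iInter.1 (hf Q).2 j hv)).2
  rw [if_neg hvM] at h1
  exact h1 rfl

/-- Let `P j` be open subsets of the part of `X` over a closed subset `C` of the base, such that no
`F`-map over `C` in the closed set `E` maps each `K j` to `P j`. The sets `P j` extend to open
subsets of `X` such that no `F`-map in `E` maps each `K j` to the extension of `P j`. -/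
theorem exists_isOpen_extension (hφ : IsFibreFunctor φ) (hX : X.IsBundle) [CompactSpace B]
    [T2Space B] [SecondCountableTopology B] {V : F} {J : Type*} [Finite J]
    {K : J → Set (φ.obj V)} (hK : ∀ j, IsCompact (K j)) {j₀ : J}
    (hK₀ : IsProperTest φ V (K j₀)) {C : Set B} (hC : IsClosed C) {E : Set (FunctionSpace X V)}
    (hE : IsClosed E) {P : J → Set X.Total} (hPC : ∀ j, P j ⊆ X.proj ⁻¹' C)
    (hP : ∀ j, IsClosed (X.proj ⁻¹' C \ P j))
    (hPE : ∀ f ∈ E, f.pt ∈ C → ¬ ∀ j, Set.MapsTo f.map (K j) (P j)) :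
    ∃ P' : J → Set X.Total, (∀ j, IsOpen (P' j)) ∧ (∀ j, P' j ∩ X.proj ⁻¹' C = P j) ∧
      ∀ f ∈ E, ¬ ∀ j, Set.MapsTo f.map (K j) (P' j) := by
  have := hX.t2Space hφ
  have := hX.weaklyLocallyCompactSpace hφ
  have := hX.secondCountableTopology hφ
  have hS : IsClosed (X.proj ⁻¹' C : Set X.Total) := hC.preimage X.proj.continuous
  -- `P j` is the intersection of an open set with the closed part over `C`. Hence it is locally
  -- compact and second countable, and therefore a countable union of compact sets.
  have hPlc : ∀ j, IsLocallyClosed (P j) := fun j => by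
    refine ⟨(X.proj ⁻¹' C \ P j)ᶜ, X.proj ⁻¹' C, (hP j).isOpen_compl, hS, ?_⟩
    ext x
    have := @hPC j x
    simp only [Set.mem_inter_iff, Set.mem_compl_iff, Set.mem_sdiff]
    tauto
  have hσ : ∀ j, IsSigmaCompact (P j) := fun j => by
    have := (hPlc j).locallyCompactSpace
    exact isSigmaCompact_iff_sigmaCompactSpace.2 inferInstance
  choose L hLc hLP using hσ
  let Good : (J → Set X.Total) → Prop := fun Q => (∀ j, IsCompact (Q j)) ∧
    (∀ j, Q j ∩ X.proj ⁻¹' C ⊆ P j) ∧ ∀ f ∈ E, ¬ ∀ j, Set.MapsTo f.map (K j) (Q j)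
  have step : ∀ (n : ℕ) (Q : {Q // Good Q}), ∃ Q' : {Q // Good Q},
      (∀ j, Q.1 j ⊆ interior (Q'.1 j)) ∧ ∀ j, L j n ⊆ interior (Q'.1 j) := by
    rintro n ⟨Q, hQ1, hQ2, hQ3⟩
    have hLn : ∀ j, L j n ⊆ P j := fun j => hLP j ▸ Set.subset_iUnion (L j) n
    obtain ⟨Q', h1, h2, h3, h4⟩ := exists_compact_nhds_extension hφ hX hK₀ hE
      (M := fun j => Q j ∪ L j n) (Ω := fun j => (X.proj ⁻¹' C \ P j)ᶜ)
      (fun j => (hQ1 j).union (hLc j n)) (fun j => (hP j).isOpen_compl)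
      (fun j => by
        rintro x (hx | hx) hx'
        · exact hx'.2 (hQ2 j ⟨hx, hx'.1⟩)
        · exact hx'.2 (hLn j hx))
      -- A bad map over `C` would send each `K j` into `P j`, against `hPE`. Away from `C` it cannot
      -- meet the sets `L j n`, which lie over `C`, so it would already be bad for `Q`.
      (fun f hf hfM => by
        by_cases hfC : f.pt ∈ C
        · refine hPE f hf hfC fun j v hv => ?_
          rcases hfM j hv with h | h
          · exact hQ2 j ⟨h, by rwa [Set.mem_preimage, f.proj_map]⟩
          · exact hLn j h
        · refine hQ3 f hf fun j v hv => (hfM j hv).resolve_right fun h => hfC ?_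
          rw [← f.proj_map v]
          exact hPC j (hLn j h))
    refine ⟨⟨Q', h1, fun j x hx => ?_, h4⟩, fun j => Set.subset_union_left.trans (h2 j),
      fun j => Set.subset_union_right.trans (h2 j)⟩
    by_contra hxP
    exact h3 j hx.1 ⟨hx.2, hxP⟩
  choose next hnext hnextL using step
  -- The exhaustion starts from empty sets; no map is bad for them because `K j₀` is non-empty.
  have h0 : Good fun _ => ∅ := by
    refine ⟨fun _ => isCompact_empty, fun j => by simp, fun f _ h => ?_⟩
    obtain ⟨v, hv⟩ := hK₀.nonempty
    exact h j₀ hv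
  let Q : ℕ → {Q // Good Q} := fun n => Nat.rec ⟨_, h0⟩ (fun n Q => next n Q) n
  have hQs : ∀ n j, (Q n).1 j ⊆ interior ((Q (n + 1)).1 j) := fun n j => hnext n (Q n) j
  have hQL : ∀ n j, L j n ⊆ interior ((Q (n + 1)).1 j) := fun n j => hnextL n (Q n) j
  have hmono : ∀ j, Monotone fun n => interior ((Q n).1 j) := fun j =>
    monotone_nat_of_le_succ fun n => interior_subset.trans (hQs n j)
  refine ⟨fun j => ⋃ n, interior ((Q n).1 j), fun j => isOpen_iUnion fun n => isOpen_interior,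
    fun j => Set.Subset.antisymm ?_ ?_, fun f hf hfP => ?_⟩
  · rintro x ⟨hx, hxC⟩
    obtain ⟨n, hn⟩ := Set.mem_iUnion.1 hx
    exact (Q n).2.2.1 j ⟨interior_subset hn, hxC⟩
  · intro x hx
    refine ⟨?_, hPC j hx⟩
    rw [← hLP j] at hx
    obtain ⟨n, hn⟩ := Set.mem_iUnion.1 hx
    exact Set.mem_iUnion.2 ⟨n + 1, hQL n j hn⟩
  -- By compactness each `K j` is sent into one stage of the increasing union; as `J` is finite, a
  -- single stage `N` serves all indices and contradicts `Good`.
  · have hn : ∀ j, ∃ n, Set.MapsTo f.map (K j) (interior ((Q n).1 j)) := fun j => by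
      obtain ⟨n, hn⟩ := ((hK j).image f.map.continuous).elim_directed_cover
        (fun n => interior ((Q n).1 j)) (fun n => isOpen_interior) (hfP j).image_subset
        (hmono j).directed_le
      exact ⟨n, Set.mapsTo_iff_image_subset.2 hn⟩
    choose n hn using hn
    obtain ⟨N, hN⟩ := Finite.exists_le n
    exact (Q N).2.2.2 f hf fun j => (hn j).mono_right ((hmono j (hN j)).trans interior_subset)

end

section

variable {F : Type u} [SmallCategory F] {φ : F ⥤ TopCat.{u}}
  {B : Type u} [TopologicalSpace B] {X : FibreFamily φ B}

/-! ### Bundles over CW-complexes -/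

/-- A subset of a bundle over a CW-complex is closed if its parts over the closed cells are. -/
theorem FibreFamily.IsBundle.isClosed_of_closedCell [T2Space B]
    [CWComplex (Set.univ : Set B)] (hX : X.IsBundle) (hφ : IsFibreFunctor φ) {T : Set X.Total}
    (hT : ∀ n (e : RelCWComplex.cell (Set.univ : Set B) n),
      IsClosed (T ∩ X.proj ⁻¹' RelCWComplex.closedCell n e)) : IsClosed T := by
  let q : (Σ (n : ℕ) (e : RelCWComplex.cell (Set.univ : Set B) n),
    (RelCWComplex.closedCell n e : Set B)) → B := fun p => p.2.2.1
  have hq : IsQuotientMap q := by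
    refine isQuotientMap_iff_isClosed.2 ⟨fun b => ?_, fun A => ⟨fun h => ?_, fun h => ?_⟩⟩
    · have hb : b ∈ ⋃ (n : ℕ) (j : RelCWComplex.cell (Set.univ : Set B) n),
          RelCWComplex.closedCell n j := by
        rw [CWComplex.union]; trivial
      simp only [Set.mem_iUnion] at hb
      obtain ⟨n, e, hb⟩ := hb
      exact ⟨⟨n, e, b, hb⟩, rfl⟩
    · refine h.preimage ?_
      exact continuous_sigma fun n => continuous_sigma fun e => continuous_subtype_val
    · rw [CWComplex.closed (Set.univ : Set B) A (Set.subset_univ _)]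
      intro n e
      have h1 : IsClosed (Subtype.val ⁻¹' A : Set (RelCWComplex.closedCell n e : Set B)) :=
        h.preimage (continuous_sigmaMk.comp continuous_sigmaMk :
          Continuous fun b : (RelCWComplex.closedCell n e : Set B) =>
            (⟨n, e, b⟩ : Σ (n : ℕ) (e : RelCWComplex.cell (Set.univ : Set B) n),
              (RelCWComplex.closedCell n e : Set B)))
      have h2 := RelCWComplex.isClosed_closedCell.isClosedEmbedding_subtypeVal.isClosedMap _ h1
      rwa [Subtype.image_preimage_coe, Set.inter_comm] at h2
  rw [← isOpen_compl_iff, isOpen_iff_mem_nhds]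
  intro x hx
  obtain ⟨U, W, hU, ⟨t⟩⟩ := hX.exists_triv (X.proj x)
  have := hφ.locallyCompact W
  have hqU := hq.restrictPreimage_isOpen t.isOpen
  -- Openness of the complement of `T` becomes continuity of a map to the Sierpiński space `Prop`.
  -- The disjoint union of closed cells maps onto the base by a quotient map, and this remains one
  -- over the open set `U` and after taking the product with the locally compact space `φ W`; so
  -- continuity can be tested cell by cell.
  let g : U × φ.obj W → Prop := fun p => (t.homeo.symm p).1 ∉ T
  have hg : Continuous g := by
    refine hqU.continuous_lift_prod_left (continuous_Prop.2 ?_)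
    let s (n : ℕ) (e : RelCWComplex.cell (Set.univ : Set B) n) :
        ↥(RelCWComplex.closedCell n e : Set B) →
          Σ (n : ℕ) (e : RelCWComplex.cell (Set.univ : Set B) n),
          (RelCWComplex.closedCell n e : Set B) := fun b => ⟨n, e, b⟩
    have hs (n : ℕ) (e : RelCWComplex.cell (Set.univ : Set B) n) : IsOpenEmbedding (s n e) :=
      IsOpenEmbedding.comp IsOpenEmbedding.sigmaMk IsOpenEmbedding.sigmaMk
    have hsU (n : ℕ) (e : RelCWComplex.cell (Set.univ : Set B) n) :=
      ((hs n e).restrictPreimage (q ⁻¹' U)).isOpenMap.prodMap (IsOpenMap.id (X := φ.obj W))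
    refine isOpen_iff_mem_nhds.2 ?_
    rintro ⟨⟨⟨n, e, b⟩, hb⟩, w⟩ hp
    refine Filter.mem_of_superset (((hsU n e) {p | (t.homeo.symm (⟨p.1.1.1, p.1.2⟩, p.2)).1 ∉ T}
      ?_).mem_nhds ⟨(⟨b, hb⟩, w), hp, rfl⟩) ?_
    · have hc : Continuous fun p : (s n e ⁻¹' (q ⁻¹' U)) × φ.obj W =>
          (t.homeo.symm (⟨p.1.1.1, p.1.2⟩, p.2)).1 := by fun_prop
      convert (hT n e).isOpen_compl.preimage hc using 1
      ext p
      have : X.proj (t.homeo.symm (⟨p.1.1.1, p.1.2⟩, p.2)).1 ∈ RelCWComplex.closedCell n e := by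
        rw [t.proj_homeo_symm]
        exact p.1.1.2
      simp [this]
    · rintro _ ⟨p, hp, rfl⟩
      exact hp
  have ho : IsOpen {p | g p} := continuous_Prop.1 hg
  have ho' := t.isOpen_preimage.isOpenMap_subtype_val _ (ho.preimage t.homeo.continuous)
  refine Filter.mem_of_superset (ho'.mem_nhds ⟨⟨x, hU⟩, ?_, rfl⟩) ?_
  · change (t.homeo.symm (t.homeo _)).1 ∉ T
    rwa [t.homeo.symm_apply_apply]
  · rintro _ ⟨y, hy, rfl⟩
    change (t.homeo.symm (t.homeo y)).1 ∉ T at hy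
    rwa [t.homeo.symm_apply_apply] at hy

/-- A closed cell is the continuous image of a closed ball in a finite-dimensional space, to which
`secondCountableTopology_of_isClosedMap` applies. -/
theorem secondCountableTopology_closedCell [T2Space B] [CWComplex (Set.univ : Set B)] (n : ℕ)
    (e : RelCWComplex.cell (Set.univ : Set B) n) :
    SecondCountableTopology (RelCWComplex.closedCell n e : Set B) := by
  have := isCompact_iff_compactSpace.1 (isCompact_closedBall (0 : Fin n → ℝ) 1)
  let f : Metric.closedBall (0 : Fin n → ℝ) 1 → ↥(RelCWComplex.closedCell n e : Set B) := fun x =>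
    ⟨RelCWComplex.map n e x.1, ⟨x.1, x.2, rfl⟩⟩
  refine secondCountableTopology_of_isClosedMap f ?_ ?_
  · exact ((RelCWComplex.continuousOn n e).domRestrict).subtype_mk _
  · rintro ⟨_, x, hx, rfl⟩
    exact ⟨⟨x, hx⟩, rfl⟩

/-- If the parts of `P` over closed cells of dimension less than `n` are relatively open, so is
the part over the frontier of an `n`-cell. -/
theorem isClosed_preimage_cellFrontier_diff [T2Space B] [CWComplex (Set.univ : Set B)] {n : ℕ}
    (e : RelCWComplex.cell (Set.univ : Set B) n) {P : Set X.Total}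
    (hP : ∀ m < n, ∀ e' : RelCWComplex.cell (Set.univ : Set B) m,
      IsClosed (X.proj ⁻¹' RelCWComplex.closedCell m e' \ P)) :
    IsClosed (X.proj ⁻¹' RelCWComplex.cellFrontier n e \ P) := by
  obtain ⟨I, hI⟩ := CWComplex.cellFrontier_subset_finite_closedCell n e
  have h : X.proj ⁻¹' RelCWComplex.cellFrontier n e \ P =
      X.proj ⁻¹' RelCWComplex.cellFrontier n e ∩ ⋃ m ∈ Finset.range n, ⋃ e' ∈ I m,
        (X.proj ⁻¹' RelCWComplex.closedCell m e' \ P) := by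
    ext x
    constructor
    · rintro ⟨hx, hxP⟩
      refine ⟨hx, ?_⟩
      have := hI hx
      simp only [Set.mem_iUnion, Finset.mem_range, exists_prop] at this ⊢
      obtain ⟨m, hm, e', he', hx'⟩ := this
      exact ⟨m, hm, e', he', hx', hxP⟩
    · rintro ⟨hx, hx'⟩
      simp only [Set.mem_iUnion, Finset.mem_range, exists_prop] at hx'
      obtain ⟨m, hm, e', he', -, hxP⟩ := hx'
      exact ⟨hx, hxP⟩
  rw [h]
  refine (RelCWComplex.isClosed_cellFrontier.preimage X.proj.continuous).inter ?_
  refine Set.Finite.isClosed_biUnion (Finset.finite_toSet _) fun m hm => ?_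
  refine Set.Finite.isClosed_biUnion (Finset.finite_toSet _) fun e' _ => ?_
  exact hP m (Finset.mem_range.1 hm) e'

end

/-! ### Extension of open sets over the cells of a CW-complex -/

section

variable {F : Type u} [SmallCategory F] {φ : F ⥤ TopCat.{u}}
  {B : Type u} [TopologicalSpace B] {X : FibreFamily φ B}

theorem productFamily_fisomorphic_restrict (W : F) (D : Set B) :
    FIsomorphic ((productFamily φ W B).restrict D) (productFamily φ W D) := by
  have hid : ∀ w : φ.obj W, (φ.map (𝟙 W)).hom w = w := fun w =>
    congrArg (fun c => (TopCat.Hom.hom c) w) (φ.map_id W)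
  let f : FMap ((productFamily φ W B).restrict D) (productFamily φ W D) :=
    { toMap := ⟨fun x : {x : B × φ.obj W // x.1 ∈ D} => ((⟨x.1.1, x.2⟩, x.1.2) : D × φ.obj W),
        by fun_prop⟩
      base := ContinuousMap.id _
      comm := fun _ => rfl
      fibre := fun b => ⟨𝟙 W, fun x => hid _⟩ }
  let g : FMap (productFamily φ W D) ((productFamily φ W B).restrict D) :=
    { toMap := ⟨fun x : D × φ.obj W => (⟨(x.1.1, x.2), x.1.2⟩ : {x : B × φ.obj W // x.1 ∈ D}),
        by fun_prop⟩
      base := ContinuousMap.id _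
      comm := fun _ => rfl
      fibre := fun b => ⟨𝟙 W, fun x => hid _⟩ }
  exact ⟨f, g, fun _ => rfl, fun _ => rfl, fun _ => rfl, fun _ => rfl⟩

/-- The `F`-map `(X|D)|U → (X|U)|D`. -/
def FibreFamily.restrictSwap (X : FibreFamily φ B) (D U : Set B) :
    FMap ((X.restrict D).restrict (Subtype.val ⁻¹' U))
      ((X.restrict U).restrict (Subtype.val ⁻¹' D)) where
  toMap := ⟨fun x => ⟨⟨x.1.1, x.2⟩, x.1.2⟩, by
    have h := (((X.restrict D).restrictIncl (Subtype.val ⁻¹' U)).toMap.continuous)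
    exact (((X.restrictIncl D).toMap.continuous.comp h).subtype_mk _).subtype_mk _⟩
  base := ⟨fun b => ⟨⟨b.1.1, b.2⟩, b.1.2⟩,
    ((continuous_subtype_val.comp continuous_subtype_val).subtype_mk _).subtype_mk _⟩
  comm := fun _ => rfl
  fibre := fun b => ⟨𝟙 (X.fib b.1.1), fun x =>
    congrArg (fun c => (TopCat.Hom.hom c) _) (φ.map_id (X.fib b.1.1))⟩

/-- A trivialization over `U` restricts to `U ∩ D`, after exchanging the order of the two
restrictions by `restrictSwap`. -/
theorem FibreFamily.IsBundle.restrict (hX : X.IsBundle) (D : Set B) :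
    (X.restrict D).IsBundle := by
  intro b
  obtain ⟨U, W, hU, ⟨t⟩⟩ := hX.exists_triv b.1
  refine ⟨Subtype.val ⁻¹' U, (t.isOpen.preimage continuous_subtype_val).mem_nhds hU, ?_⟩
  refine FibreFamily.IsTrivial.of_fisomorphic (Y := (X.restrict U).restrict (Subtype.val ⁻¹' D))
    ⟨W, ?_⟩ ⟨X.restrictSwap D U, X.restrictSwap U D, fun _ => rfl, fun _ => rfl, fun _ => rfl,
      fun _ => rfl⟩
  have h := FIsomorphic.restrict t.inv_fwd t.fwd_inv
    (fun b => (t.inv_base _).trans (t.fwd_base b)) (fun b => (t.fwd_base _).trans (t.inv_base b))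
    (Subtype.val ⁻¹' D)
  have he : t.fwd.base ⁻¹' (Subtype.val ⁻¹' D) = Subtype.val ⁻¹' D :=
    Set.ext fun b => by rw [Set.mem_preimage, t.fwd_base]
  rw [he] at h
  exact h.trans (productFamily_fisomorphic_restrict W _)

variable [φ.Faithful]

/-- `exists_isOpen_extension` over a single closed cell. -/
theorem exists_extension_closedCell (hφ : IsFibreFunctor φ) (hX : X.IsBundle) [T2Space B]
    [CWComplex (Set.univ : Set B)] {V : F} {J : Type*} [Finite J]
    {K : J → Set (φ.obj V)} (hK : ∀ j, IsCompact (K j)) {j₀ : J}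
    (hK₀ : IsProperTest φ V (K j₀)) {N : Set (FunctionSpace X V)}
    (hN : IsClosed N) {P : J → Set X.Total} {n : ℕ}
    (e : RelCWComplex.cell (Set.univ : Set B) n)
    (hP : ∀ j, IsClosed (X.proj ⁻¹' RelCWComplex.cellFrontier n e \ P j))
    (hPN : ∀ f ∈ N, f.pt ∈ RelCWComplex.cellFrontier n e →
      ¬ ∀ j, Set.MapsTo f.map (K j) (P j)) :
    ∃ P' : J → Set X.Total, (∀ j, P' j ⊆ X.proj ⁻¹' RelCWComplex.closedCell n e) ∧
      (∀ j, IsClosed (X.proj ⁻¹' RelCWComplex.closedCell n e \ P' j)) ∧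
      (∀ j, P' j ∩ X.proj ⁻¹' RelCWComplex.cellFrontier n e =
        P j ∩ X.proj ⁻¹' RelCWComplex.cellFrontier n e) ∧
      ∀ f ∈ N, f.pt ∈ RelCWComplex.closedCell n e → ¬ ∀ j, Set.MapsTo f.map (K j) (P' j) := by
  let D := RelCWComplex.closedCell n e
  have hDc : IsClosed (X.proj ⁻¹' D : Set X.Total) :=
    RelCWComplex.isClosed_closedCell.preimage X.proj.continuous
  have : CompactSpace D := isCompact_iff_compactSpace.1 RelCWComplex.isCompact_closedCell
  have := secondCountableTopology_closedCell n e
  have hfD : RelCWComplex.cellFrontier n e ⊆ D := RelCWComplex.cellFrontier_subset_closedCell n e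
  -- The closed cell is a compact, second countable base, and its frontier plays the role of the
  -- closed subset `C`.
  obtain ⟨P', h1, h2, h3⟩ := exists_isOpen_extension hφ (hX.restrict D) hK hK₀
    (C := Subtype.val ⁻¹' RelCWComplex.cellFrontier n e)
    (RelCWComplex.isClosed_cellFrontier.preimage continuous_subtype_val)
    (hN.preimage ((X.restrictIncl D).continuous_postcomp V))
    (P := fun j => Subtype.val ⁻¹' (P j ∩ X.proj ⁻¹' RelCWComplex.cellFrontier n e))
    (fun j x hx => hx.2)
    (fun j => by
      have h := (hP j).preimage (X.restrictIncl D).toMap.continuous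
      refine (congrArg IsClosed (Set.ext fun x => ?_)).mpr h
      exact ⟨fun h => ⟨h.1, fun h' => h.2 ⟨h', h.1⟩⟩, fun h => ⟨h.1, fun h' => h.2 h'.1⟩⟩)
    (fun f hf hfC hfP => hPN _ hf hfC fun j v hv => (hfP j hv).1)
  refine ⟨fun j => Subtype.val '' P' j, ?_, fun j => ?_, fun j => ?_, fun f hf hfD hfP => ?_⟩
  · rintro j _ ⟨x, -, rfl⟩
    exact x.2
  · have := hDc.isClosedEmbedding_subtypeVal.isClosedMap _ (h1 j).isClosed_compl
    convert this using 1
    ext x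
    constructor
    · rintro ⟨hx, hx'⟩
      exact ⟨⟨x, hx⟩, fun h => hx' ⟨_, h, rfl⟩, rfl⟩
    · rintro ⟨x, hx, rfl⟩
      exact ⟨x.2, by rintro ⟨y, hy, hyx⟩; exact hx (Subtype.ext hyx ▸ hy)⟩
  · ext x
    constructor
    · rintro ⟨⟨y, hy, rfl⟩, hx⟩
      have : y ∈ P' j ∩ (X.restrict D).proj ⁻¹' (Subtype.val ⁻¹' RelCWComplex.cellFrontier n e) :=
        ⟨hy, hx⟩
      rw [h2] at this
      exact this
    · intro hx
      have := (Set.ext_iff.1 (h2 j) ⟨x, hfD hx.2⟩).2 hx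
      exact ⟨⟨_, this.1, rfl⟩, hx.2⟩
  · refine h3 (f.codRestrict D hfD) ?_ fun j v hv => ?_
    · exact hf
    · obtain ⟨y, hy, hyv⟩ := hfP j hv
      have : (f.codRestrict D hfD).map v = y := Subtype.ext hyv.symm
      rwa [this]

/-- The extension of open sets from a subcomplex and the `n - 1`-skeleton to the `n`-skeleton. -/
theorem exists_extension_skeleton (hφ : IsFibreFunctor φ) (hX : X.IsBundle) [T2Space B]
    [CWComplex (Set.univ : Set B)] (E : RelCWComplex.Subcomplex (Set.univ : Set B)) {V : F}
    {J : Type*} [Finite J] {K : J → Set (φ.obj V)} (hK : ∀ j, IsCompact (K j)) {j₀ : J}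
    (hK₀ : IsProperTest φ V (K j₀)) {N : Set (FunctionSpace X V)}
    (hN : IsClosed N) (n : ℕ) {P : J → Set X.Total}
    (hPC : ∀ j, P j ⊆ X.proj ⁻¹' (E ∪ RelCWComplex.skeletonLT (Set.univ : Set B) n))
    (hPE : ∀ j, IsClosed (X.proj ⁻¹' (E : Set B) \ P j))
    (hP : ∀ j, ∀ m < n, ∀ e : RelCWComplex.cell (Set.univ : Set B) m,
      IsClosed (X.proj ⁻¹' RelCWComplex.closedCell m e \ P j))
    (hPN : ∀ f ∈ N, f.pt ∈ (E ∪ RelCWComplex.skeletonLT (Set.univ : Set B) n : Set B) →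
      ¬ ∀ j, Set.MapsTo f.map (K j) (P j)) :
    ∃ P' : J → Set X.Total,
      (∀ j, P' j ⊆ X.proj ⁻¹' (E ∪ RelCWComplex.skeletonLT (Set.univ : Set B) (n + 1 : ℕ))) ∧
      (∀ j, P' j ∩ X.proj ⁻¹' (E ∪ RelCWComplex.skeletonLT (Set.univ : Set B) n) = P j) ∧
      (∀ j, ∀ m < n + 1, ∀ e : RelCWComplex.cell (Set.univ : Set B) m,
        IsClosed (X.proj ⁻¹' RelCWComplex.closedCell m e \ P' j)) ∧
      ∀ f ∈ N, f.pt ∈ (E ∪ RelCWComplex.skeletonLT (Set.univ : Set B) (n + 1 : ℕ) : Set B) →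
        ¬ ∀ j, Set.MapsTo f.map (K j) (P' j) := by
  have hfr : ∀ e : RelCWComplex.cell (Set.univ : Set B) n, RelCWComplex.cellFrontier n e ⊆
      RelCWComplex.skeletonLT (Set.univ : Set B) n :=
    fun e => RelCWComplex.cellFrontier_subset_skeletonLT n e
  choose Q hQD hQc hQP hQN using fun e : RelCWComplex.cell (Set.univ : Set B) n =>
    exists_extension_closedCell hφ hX hK hK₀ hN (P := P) e
      (fun j => isClosed_preimage_cellFrontier_diff e (hP j))
      (fun f hf hfe => hPN f hf (Or.inr (hfr e hfe)))
  have hdis : ∀ e ∉ E.I n, Disjoint (RelCWComplex.openCell n e)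
      (E ∪ RelCWComplex.skeletonLT (Set.univ : Set B) n) := fun e he => by
    refine Disjoint.union_right (E.disjoint_openCell_subcomplex_of_not_mem he)
      (RelCWComplex.Subcomplex.disjoint_openCell_subcomplex_of_not_mem _ ?_)
    simp [RelCWComplex.skeletonLT_I]
  -- Only cells outside `E` receive something new, and only over their open cells. Open cells are
  -- disjoint from one another and from the old part, so the extensions do not interfere and `P` is
  -- unchanged where it was given.
  let P' : J → Set X.Total := fun j => P j ∪
    ⋃ e ∈ (E.I n)ᶜ, (Q e j ∩ X.proj ⁻¹' RelCWComplex.openCell n e)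
  have hPP : ∀ j, P' j ∩ X.proj ⁻¹' (E ∪ RelCWComplex.skeletonLT (Set.univ : Set B) n) = P j := by
    intro j
    refine Set.Subset.antisymm ?_ fun x hx => ⟨Or.inl hx, hPC j hx⟩
    rintro x ⟨hx | hx, hx'⟩
    · exact hx
    · simp only [Set.mem_iUnion] at hx
      obtain ⟨e, he, -, hx⟩ := hx
      exact ((hdis e he).le_bot ⟨hx, hx'⟩).elim
  have hPQ : ∀ j, ∀ e ∉ E.I n, P' j ∩ X.proj ⁻¹' RelCWComplex.closedCell n e = Q e j := by
    intro j e he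
    ext x
    by_cases hxe : X.proj x ∈ RelCWComplex.closedCell n e
    · rw [← RelCWComplex.cellFrontier_union_openCell_eq_closedCell] at hxe
      rcases hxe with hxe | hxe
      · have h1 : x ∈ P' j ↔ x ∈ P j := by
          rw [← hPP j]
          exact ⟨fun h => ⟨h, Or.inr (hfr e hxe)⟩, fun h => h.1⟩
        have h2 : x ∈ Q e j ↔ x ∈ P j := by
          have := Set.ext_iff.1 (hQP e j) x
          simpa [hxe] using this
        have h3 := RelCWComplex.cellFrontier_subset_closedCell n e hxe
        rw [h2, ← h1]
        exact ⟨fun h => h.1, fun h => ⟨h, h3⟩⟩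
      · have h3 := RelCWComplex.openCell_subset_closedCell n e hxe
        constructor
        · rintro ⟨hx | hx, -⟩
          · exact ((hdis e he).le_bot ⟨hxe, hPC j hx⟩).elim
          · simp only [Set.mem_iUnion] at hx
            obtain ⟨e', he', hx, hxe'⟩ := hx
            by_cases hee : e' = e
            · exact hee ▸ hx
            · have hd : Disjoint (RelCWComplex.openCell n e') (RelCWComplex.openCell n e) :=
                RelCWComplex.disjoint_openCell_of_ne (by simpa using hee)
              exact (hd.le_bot ⟨hxe', hxe⟩).elim
        · intro hx
          refine ⟨Or.inr ?_, h3⟩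
          simp only [Set.mem_iUnion]
          exact ⟨e, he, hx, hxe⟩
    · exact ⟨fun h => (hxe h.2).elim, fun h => (hxe (hQD e j h)).elim⟩
  have hsk : (RelCWComplex.skeletonLT (Set.univ : Set B) n : Set B) ∪
      ⋃ e : RelCWComplex.cell (Set.univ : Set B) n, RelCWComplex.closedCell n e =
        RelCWComplex.skeletonLT (Set.univ : Set B) (n + 1 : ℕ) := by
    have := RelCWComplex.skeletonLT_union_iUnion_closedCell_eq_skeletonLT_succ
      (C := (Set.univ : Set B)) n
    exact_mod_cast this
  refine ⟨P', fun j => ?_, hPP, fun j m hm e => ?_, fun f hf hfn hfP => ?_⟩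
  · rw [← hsk]
    rintro x (hx | hx)
    · exact (hPC j hx).imp id Or.inl
    · simp only [Set.mem_iUnion] at hx
      obtain ⟨e, -, -, hx⟩ := hx
      exact Or.inr (Or.inr (Set.mem_iUnion.2 ⟨e, RelCWComplex.openCell_subset_closedCell n e hx⟩))
  · have key : ∀ D : Set B, D ⊆ (E ∪ RelCWComplex.skeletonLT (Set.univ : Set B) n : Set B) →
        X.proj ⁻¹' D \ P' j = X.proj ⁻¹' D \ P j := by
      intro D hD
      ext x
      refine and_congr_right fun hx => not_congr ?_
      rw [← hPP j]
      exact ⟨fun h => ⟨h, hD hx⟩, fun h => h.1⟩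
    rcases Nat.lt_succ_iff_lt_or_eq.1 hm with hm | rfl
    · rw [key]
      · exact hP j m hm e
      · refine Set.subset_union_of_subset_right ?_ _
        refine (RelCWComplex.closedCell_subset_skeletonLT m e).trans
          (RelCWComplex.skeletonLT_mono ?_)
        exact_mod_cast hm
    · by_cases he : e ∈ E.I m
      · have hE : RelCWComplex.closedCell m e ⊆ (E : Set B) := E.closedCell_subset_of_mem he
        rw [key _ (Set.subset_union_of_subset_left hE _)]
        convert (RelCWComplex.isClosed_closedCell.preimage X.proj.continuous).inter (hPE j) using 1
        · ext x
          exact ⟨fun h => ⟨h.1, hE h.1, h.2⟩, fun h => ⟨h.1, h.2.2⟩⟩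
      · convert hQc e j using 1
        rw [← hPQ j e he]
        ext x
        simp
  · by_cases hfo : f.pt ∈ (E ∪ RelCWComplex.skeletonLT (Set.univ : Set B) n : Set B)
    · refine hPN f hf hfo fun j v hv => ?_
      rw [← hPP j]
      exact ⟨hfP j hv, by rwa [Set.mem_preimage, f.proj_map]⟩
    · rw [← hsk, ← Set.union_assoc] at hfn
      have hfe := hfn.resolve_left hfo
      obtain ⟨e, hfe⟩ := Set.mem_iUnion.1 hfe
      have he : e ∉ E.I n := fun he => hfo (Or.inl (E.closedCell_subset_of_mem he hfe))
      refine hQN e f hf hfe fun j v hv => ?_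
      rw [← hPQ j e he]
      exact ⟨hfP j hv, by rwa [Set.mem_preimage, f.proj_map]⟩

/-- Let `X` be a bundle over a CW-complex and let `P j` be open subsets of its part over a
subcomplex `E` such that no `F`-map over `E` in the closed set `N` maps each `K j` to `P j`.
The sets `P j` extend to open subsets of `X` such that no `F`-map in `N` maps each `K j` to the
extension of `P j`. -/
theorem exists_isOpen_extension_subcomplex (hφ : IsFibreFunctor φ) (hX : X.IsBundle) [T2Space B]
    [CWComplex (Set.univ : Set B)] (E : RelCWComplex.Subcomplex (Set.univ : Set B)) {V : F}
    {J : Type*} [Finite J] {K : J → Set (φ.obj V)} (hK : ∀ j, IsCompact (K j)) {j₀ : J}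
    (hK₀ : IsProperTest φ V (K j₀)) {N : Set (FunctionSpace X V)} (hN : IsClosed N)
    {P : J → Set X.Total} (hPC : ∀ j, P j ⊆ X.proj ⁻¹' (E : Set B))
    (hPE : ∀ j, IsClosed (X.proj ⁻¹' (E : Set B) \ P j))
    (hPN : ∀ f ∈ N, f.pt ∈ (E : Set B) → ¬ ∀ j, Set.MapsTo f.map (K j) (P j)) :
    ∃ P' : J → Set X.Total, (∀ j, IsOpen (P' j)) ∧
      (∀ j, P' j ∩ X.proj ⁻¹' (E : Set B) = P j) ∧
      ∀ f ∈ N, ¬ ∀ j, Set.MapsTo f.map (K j) (P' j) := by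
  let A : ℕ → Set B := fun n => E ∪ RelCWComplex.skeletonLT (Set.univ : Set B) n
  have hA : Monotone A := fun m n h => Set.union_subset_union_right _
    (RelCWComplex.skeletonLT_mono (by exact_mod_cast h))
  let Good : ℕ → (J → Set X.Total) → Prop := fun n P => (∀ j, P j ⊆ X.proj ⁻¹' A n) ∧
    (∀ j, IsClosed (X.proj ⁻¹' (E : Set B) \ P j)) ∧
    (∀ j, ∀ m < n, ∀ e : RelCWComplex.cell (Set.univ : Set B) m,
      IsClosed (X.proj ⁻¹' RelCWComplex.closedCell m e \ P j)) ∧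
    ∀ f ∈ N, f.pt ∈ A n → ¬ ∀ j, Set.MapsTo f.map (K j) (P j)
  have step : ∀ (n : ℕ) (P : {P // Good n P}), ∃ P' : {P // Good (n + 1) P},
      ∀ j, P'.1 j ∩ X.proj ⁻¹' A n = P.1 j := by
    rintro n ⟨P, h1, h2, h3, h4⟩
    obtain ⟨P', h1', h2', h3', h4'⟩ := exists_extension_skeleton hφ hX E hK hK₀ hN n h1 h2 h3 h4
    refine ⟨⟨P', h1', fun j => ?_, h3', h4'⟩, h2'⟩
    convert h2 j using 1
    ext x
    refine and_congr_right fun hx => not_congr ?_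
    rw [← h2' j]
    exact ⟨fun h => ⟨h, Or.inl hx⟩, fun h => h.1⟩
  choose next hnext using step
  -- `skeletonLT 0` is empty, so the induction starts exactly from the given data over `E`.
  have hA0 : A 0 = E := by
    have : (RelCWComplex.skeletonLT (Set.univ : Set B) (0 : ℕ) : Set B) = ∅ := by
      exact_mod_cast RelCWComplex.skeletonLT_zero_eq_base (C := (Set.univ : Set B))
    simp only [A, this, Set.union_empty]
  have h0 : Good 0 P := by
    refine ⟨by rwa [hA0], hPE, fun j m hm => (Nat.not_lt_zero m hm).elim, by rwa [hA0]⟩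
  let Q : (n : ℕ) → {P // Good n P} := fun n => Nat.rec ⟨P, h0⟩ (fun n Q => next n Q) n
  have hQs : ∀ n j, (Q (n + 1)).1 j ∩ X.proj ⁻¹' A n = (Q n).1 j := fun n j => hnext n (Q n) j
  have hQm : ∀ j n k, (Q (n + k)).1 j ∩ X.proj ⁻¹' A n = (Q n).1 j := by
    intro j n k
    induction k with
    | zero => exact Set.inter_eq_left.2 ((Q n).2.1 j)
    | succ k ih =>
      rw [← ih, ← hQs (n + k) j, Set.inter_assoc, Set.inter_eq_right.2
        (Set.preimage_mono (hA (Nat.le_add_right n k)))]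
      rfl
  have hQU : ∀ j n, (⋃ m, (Q m).1 j) ∩ X.proj ⁻¹' A n = (Q n).1 j := by
    intro j n
    refine Set.Subset.antisymm ?_ fun x hx => ⟨Set.mem_iUnion.2 ⟨n, hx⟩, (Q n).2.1 j hx⟩
    rintro x ⟨hx, hxn⟩
    obtain ⟨m, hm⟩ := Set.mem_iUnion.1 hx
    have h1 : x ∈ (Q (n + m)).1 j := by
      have := hQm j m n
      rw [add_comm m n] at this
      rw [← this] at hm
      exact hm.1
    rw [← hQm j n m]
    exact ⟨h1, hxn⟩
  refine ⟨fun j => ⋃ n, (Q n).1 j, fun j => ?_, fun j => ?_, fun f hf hfP => ?_⟩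
  · rw [← isClosed_compl_iff]
    -- Over an `n`-cell the union of all stages agrees with stage `n + 1`, the first one whose
    -- condition covers cells of dimension `n`.
    refine hX.isClosed_of_closedCell hφ fun n e => ?_
    convert (Q (n + 1)).2.2.2.1 j n (Nat.lt_succ_self n) e using 1
    have hn : RelCWComplex.closedCell n e ⊆ A (n + 1) := by
      refine Set.subset_union_of_subset_right ?_ _
      exact_mod_cast RelCWComplex.closedCell_subset_skeletonLT n e
    ext x
    rw [Set.inter_comm]
    refine and_congr_right fun hx => not_congr ?_
    rw [← hQU j (n + 1)]
    exact ⟨fun h => ⟨h, hn hx⟩, fun h => h.1⟩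
  · rw [← hA0]
    exact hQU j 0
  · obtain ⟨n, hn⟩ : ∃ n, f.pt ∈ A n := by
      have : f.pt ∈ ⋃ n : ℕ, (RelCWComplex.skeletonLT (Set.univ : Set B) n : Set B) := by
        rw [RelCWComplex.iUnion_skeletonLT_eq_complex]; trivial
      obtain ⟨n, hn⟩ := Set.mem_iUnion.1 this
      exact ⟨n, Or.inr hn⟩
    refine (Q n).2.2.2.2 f hf hn fun j v hv => ?_
    rw [← hQU j n]
    exact ⟨hfP j hv, by rwa [Set.mem_preimage, f.proj_map]⟩

end

section

/-! ### Push-outs of topological spaces -/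

section Pushout

variable {A X Y Z : Type u} [TopologicalSpace A] [TopologicalSpace X] [TopologicalSpace Y]
  [TopologicalSpace Z] {f : C(A, X)} {i : C(A, Y)} {j : C(X, Z)} {k : C(Y, Z)}

/-- The universal property of a push-out of spaces, for maps to a topological space. -/
theorem exists_desc (h : IsPushout (TopCat.ofHom f) (TopCat.ofHom i) (TopCat.ofHom j)
    (TopCat.ofHom k)) {T : Type u} [TopologicalSpace T] (a : C(X, T)) (b : C(Y, T))
    (hab : ∀ x, a (f x) = b (i x)) :
    ∃ d : C(Z, T), (∀ x, d (j x) = a x) ∧ ∀ y, d (k y) = b y := by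
  have w : TopCat.ofHom f ≫ TopCat.ofHom a = TopCat.ofHom i ≫ TopCat.ofHom b :=
    TopCat.hom_ext (ContinuousMap.ext hab)
  refine ⟨(h.desc _ _ w).hom, fun x => ?_, fun y => ?_⟩
  · exact congrArg (fun c => (TopCat.Hom.hom c) x) (h.inl_desc _ _ w)
  · exact congrArg (fun c => (TopCat.Hom.hom c) y) (h.inr_desc _ _ w)

/-- The universal property of a push-out of spaces, for maps to a set. -/
theorem exists_desc_prop (h : IsPushout (TopCat.ofHom f) (TopCat.ofHom i) (TopCat.ofHom j)
    (TopCat.ofHom k)) (a : X → Prop) (b : Y → Prop) (hab : ∀ x, a (f x) ↔ b (i x)) :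
    ∃ d : Z → Prop, (∀ x, d (j x) ↔ a x) ∧ ∀ y, d (k y) ↔ b y := by
  let _ : TopologicalSpace (ULift.{u} Prop) := ⊤
  obtain ⟨d, h1, h2⟩ := exists_desc h (T := ULift.{u} Prop)
    ⟨fun x => ⟨a x⟩, continuous_top⟩ ⟨fun x => ⟨b x⟩, continuous_top⟩
    fun x => congrArg ULift.up (propext (hab x))
  exact ⟨fun z => (d z).down, fun x => iff_of_eq (congrArg ULift.down (h1 x)),
    fun y => iff_of_eq (congrArg ULift.down (h2 y))⟩

/-- Every predicate is a continuous map to an indiscrete two-point space, so uniqueness in the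
universal property forces membership in the union of the ranges to be the constant predicate `True`.
-/
theorem pushout_mem_range (h : IsPushout (TopCat.ofHom f) (TopCat.ofHom i) (TopCat.ofHom j)
    (TopCat.ofHom k)) (z : Z) : z ∈ Set.range j ∨ z ∈ Set.range k := by
  let _ : TopologicalSpace (ULift.{u} Prop) := ⊤
  let c : Z → Prop := fun z => z ∈ Set.range j ∨ z ∈ Set.range k
  have e : TopCat.ofHom (⟨fun z => ⟨c z⟩, continuous_top⟩ : C(Z, ULift.{u} Prop)) =
      TopCat.ofHom (⟨fun z => ⟨True⟩, continuous_top⟩ : C(Z, ULift.{u} Prop)) := by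
    refine h.hom_ext ?_ ?_
    · exact TopCat.hom_ext (ContinuousMap.ext fun x => congrArg ULift.up
        (eq_true (Or.inl ⟨x, rfl⟩)))
    · exact TopCat.hom_ext (ContinuousMap.ext fun x => congrArg ULift.up
        (eq_true (Or.inr ⟨x, rfl⟩)))
  exact of_eq_true (congrArg (fun g => ((TopCat.Hom.hom g) z : ULift.{u} Prop).down) e)

/-- Open sets are continuous maps to the Sierpiński space `Prop`, and these glue by the universal
property. -/
theorem pushout_isOpen_iff (h : IsPushout (TopCat.ofHom f) (TopCat.ofHom i) (TopCat.ofHom j)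
    (TopCat.ofHom k)) {U : Set Z} : IsOpen U ↔ IsOpen (j ⁻¹' U) ∧ IsOpen (k ⁻¹' U) := by
  refine ⟨fun hU => ⟨hU.preimage j.continuous, hU.preimage k.continuous⟩, fun ⟨hj, hk⟩ => ?_⟩
  obtain ⟨d, h1, h2⟩ := exists_desc h (T := ULift.{u} Prop)
    ⟨fun x => ⟨j x ∈ U⟩, continuous_uliftUp.comp (continuous_Prop.2 hj)⟩
    ⟨fun y => ⟨k y ∈ U⟩, continuous_uliftUp.comp (continuous_Prop.2 hk)⟩
    fun a => congrArg (fun c : TopCat.of A ⟶ TopCat.of Z => ULift.up (c.hom a ∈ U)) h.w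
  have hd : ∀ z, (d z).down = (z ∈ U) := by
    intro z
    rcases pushout_mem_range h z with ⟨x, rfl⟩ | ⟨y, rfl⟩
    exacts [congrArg ULift.down (h1 x), congrArg ULift.down (h2 y)]
  exact continuous_Prop.1 ((continuous_uliftDown.comp d.continuous).congr hd)

/-- For `y` outside the range of `i`, the predicate "equals `y`" on `Y` is compatible with `False`
on `X` and so descends to `Z`, where it tells `k y` from all other points `k y'`. -/
theorem pushout_inr_injective (h : IsPushout (TopCat.ofHom f) (TopCat.ofHom i) (TopCat.ofHom j)
    (TopCat.ofHom k)) {y y' : Y} (hy : y ∉ Set.range i) (hyy : k y = k y') : y = y' := by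
  obtain ⟨d, -, hd⟩ := exists_desc_prop h (fun _ => False) (fun x => y = x)
    fun a => ⟨False.elim, fun e => hy ⟨a, e.symm⟩⟩
  exact (hd y').1 (hyy ▸ (hd y).2 rfl)

theorem pushout_inl_eq_inr (h : IsPushout (TopCat.ofHom f) (TopCat.ofHom i) (TopCat.ofHom j)
    (TopCat.ofHom k)) {x : X} {y : Y} (hxy : j x = k y) : y ∈ Set.range i := by
  obtain ⟨d, hj, hk⟩ := exists_desc_prop h (fun _ => True) (fun y => y ∈ Set.range i)
    fun a => ⟨fun _ => ⟨a, rfl⟩, fun _ => trivial⟩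
  exact (hk y).1 (hxy ▸ (hj x).2 trivial)

/-- The hypotheses make `X ⊕ Y → Z` a quotient map and force every compatible pair of maps to factor
through it: since `j` is injective, all identifications come from `A`. -/
theorem isPushout_of_forall (hc : ∀ a, j (f a) = k (i a)) (hj : Function.Injective j)
    (hs : ∀ z, z ∈ Set.range j ∨ z ∈ Set.range k)
    (hk : ∀ y y', k y = k y' → y = y' ∨ y ∈ Set.range i ∧ y' ∈ Set.range i)
    (hjk : ∀ x y, j x = k y → y ∈ Set.range i)
    (ho : ∀ U : Set Z, IsOpen (j ⁻¹' U) → IsOpen (k ⁻¹' U) → IsOpen U) :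
    IsPushout (TopCat.ofHom f) (TopCat.ofHom i) (TopCat.ofHom j) (TopCat.ofHom k) := by
  have w : TopCat.ofHom f ≫ TopCat.ofHom j = TopCat.ofHom i ≫ TopCat.ofHom k :=
    TopCat.hom_ext (ContinuousMap.ext hc)
  have hq : IsQuotientMap (Sum.elim j k) := by
    refine isQuotientMap_iff_isClosed.2 ⟨fun z => ?_, fun T => ⟨fun hT => ?_, fun hT => ?_⟩⟩
    · rcases hs z with ⟨x, rfl⟩ | ⟨y, rfl⟩
      exacts [⟨Sum.inl x, rfl⟩, ⟨Sum.inr y, rfl⟩]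
    · exact hT.preimage (j.continuous.sumElim k.continuous)
    · have h := isOpen_sum_iff.1 hT.isOpen_compl
      exact isOpen_compl_iff.1 (ho _ h.1 h.2)
  have key : ∀ s : Limits.PushoutCocone (TopCat.ofHom f) (TopCat.ofHom i),
      ∃ d : C(Z, s.pt), (∀ x, d (j x) = s.inl.hom x) ∧ ∀ y, d (k y) = s.inr.hom y := by
    intro s
    have hsc : ∀ a, s.inl.hom (f a) = s.inr.hom (i a) := fun a =>
      congrArg (fun c => (TopCat.Hom.hom c) a) s.condition
    have hcomp : ∀ x y, j x = k y → s.inl.hom x = s.inr.hom y := by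
      intro x y hxy
      obtain ⟨a, rfl⟩ := hjk x y hxy
      rw [← hsc, hj (hxy.trans (hc a).symm)]
    let l : C(X ⊕ Y, s.pt) := ⟨Sum.elim s.inl.hom s.inr.hom,
      s.inl.hom.continuous.sumElim s.inr.hom.continuous⟩
    have hl : Function.FactorsThrough l (Sum.elim j k) := by
      rintro (x | y) (x' | y') he
      · exact congrArg s.inl.hom (hj he)
      · exact hcomp x y' he
      · exact (hcomp x' y he.symm).symm
      · rcases hk y y' he with rfl | ⟨⟨a, rfl⟩, ⟨a', rfl⟩⟩
        · rfl
        · have : f a = f a' := hj ((hc a).trans (he.trans (hc a').symm))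
          exact (hsc a).symm.trans ((congrArg s.inl.hom this).trans (hsc a'))
    let q : C(X ⊕ Y, Z) := ⟨Sum.elim j k, hq.continuous⟩
    have hql := IsQuotientMap.lift_comp (f := q) hq l hl
    exact ⟨IsQuotientMap.lift (f := q) hq l hl, fun x => congrArg (fun c => c (Sum.inl x)) hql,
      fun y => congrArg (fun c => c (Sum.inr y)) hql⟩
  choose d hdj hdk using key
  refine ⟨⟨w⟩, ⟨Limits.PushoutCocone.IsColimit.mk w (fun s => TopCat.ofHom (d s)) (fun s => ?_)
    (fun s => ?_) fun s m h1 h2 => ?_⟩⟩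
  · exact TopCat.hom_ext (ContinuousMap.ext (hdj s))
  · exact TopCat.hom_ext (ContinuousMap.ext (hdk s))
  · refine TopCat.hom_ext (ContinuousMap.ext fun z => ?_)
    rcases hs z with ⟨x, rfl⟩ | ⟨y, rfl⟩
    · exact (congrArg (fun c => (TopCat.Hom.hom c) x) h1).trans (hdj s x).symm
    · exact (congrArg (fun c => (TopCat.Hom.hom c) y) h2).trans (hdk s y).symm

end Pushout

end

section

variable {F : Type u} [SmallCategory F] {φ : F ⥤ TopCat.{u}}

/-! ### Function spaces of push-outs -/

section

variable {B B' : Type u} [TopologicalSpace B] [TopologicalSpace B'] {Y : FibreFamily φ B}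
  {Z : FibreFamily φ B'}

/-- The lift is `c ≫ a'`, where `c` is `g` read in its chart and `a'` is the inverse morphism on the
fibre. -/
theorem FMap.IsFibreIsoAt.exists_postcomp_eq {k : FMap Y Z} {b : B} (hk : k.IsFibreIsoAt b)
    {V : F} [Nonempty (φ.obj V)] (g : FunctionSpace Z V) (hg : g.pt = k.base b) :
    ∃ g' : FunctionSpace Y V, g'.pt = b ∧ k.postcomp g' = g := by
  obtain ⟨a, a', ha, -, haa⟩ := hk
  obtain ⟨c, hc⟩ := g.exists_hom hg
  refine ⟨FunctionSpace.ofHom Y V b (c ≫ a'), rfl, FunctionSpace.ext_of_forall fun v => ?_⟩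
  have h1 := ha ((Y.chart b).symm ((φ.map (c ≫ a')).hom v))
  rw [Homeomorph.apply_symm_apply] at h1
  have h2 : (φ.map a).hom ((φ.map (c ≫ a')).hom v) = (φ.map c).hom v := by
    refine (congrArg (fun d => (φ.map a).hom ((TopCat.Hom.hom d) v)) (φ.map_comp c a')).trans ?_
    exact congrArg (fun d => (TopCat.Hom.hom d) ((φ.map c).hom v)) haa
  exact congrArg Subtype.val ((Z.chart (k.base b)).injective (h1.symm.trans (h2.trans (hc v))))

theorem homFunctor_map_comp_eq_id [φ.Faithful] (V : F) {W W' : F} {a : W ⟶ W'} {a' : W' ⟶ W}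
    (h : φ.map a ≫ φ.map a' = 𝟙 _) :
    (homFunctor φ V).map a ≫ (homFunctor φ V).map a' = 𝟙 _ := by
  have : a ≫ a' = 𝟙 _ := φ.map_injective (by rw [φ.map_comp, h, φ.map_id])
  rw [← CategoryTheory.Functor.map_comp, this, CategoryTheory.Functor.map_id]

end

section

variable {BX BY BZ : Type u} [TopologicalSpace BX] [TopologicalSpace BY] [TopologicalSpace BZ]
  {X : FibreFamily φ BX} {Y : FibreFamily φ BY} {Z : FibreFamily φ BZ} {A : Set BY}
  {f : FMap (Y.restrict A) X} {l : FMap X Z} {r : FMap Y Z}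

theorem IsFPushout.toMap_eq (h : IsFPushout f (Y.restrictIncl A) l r)
    (a : (Y.restrict A).Total) : l.toMap (f.toMap a) = r.toMap a.1 :=
  congrArg (fun c => (TopCat.Hom.hom c) a) h.total.w

theorem IsFPushout.mem_of_eq (h : IsFPushout f (Y.restrictIncl A) l r) {x : X.Total}
    {y : Y.Total} (hxy : l.toMap x = r.toMap y) : Y.proj y ∈ A := by
  obtain ⟨a, ha⟩ := pushout_inl_eq_inr h.total hxy
  exact ha ▸ a.2

theorem IsFPushout.injective_right (h : IsFPushout f (Y.restrictIncl A) l r) {y y' : Y.Total}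
    (hy : Y.proj y ∉ A) (hyy : r.toMap y = r.toMap y') : y = y' :=
  pushout_inr_injective h.total (by rintro ⟨a, ha⟩; exact hy (ha ▸ a.2)) hyy

/-- The base is a push-out, so the base point of `g` comes from `BX` or from `BY`; a point of `A` is
moved to `BX` by the attaching map. The fibrewise isomorphism over that point provides the lift. -/
theorem IsFPushout.exists_postcomp_eq (h : IsFPushout f (Y.restrictIncl A) l r) {V : F}
    [Nonempty (φ.obj V)] (g : FunctionSpace Z V) :
    (∃ g' : FunctionSpace X V, l.postcomp g' = g) ∨
      ∃ g' : FunctionSpace Y V, g'.pt ∉ A ∧ r.postcomp g' = g := by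
  have hleft : ∀ x, l.base x = g.pt → ∃ g' : FunctionSpace X V, l.postcomp g' = g := fun x hx => by
    obtain ⟨g', -, hg'⟩ := (h.fibre_left x).exists_postcomp_eq g hx.symm
    exact ⟨g', hg'⟩
  rcases pushout_mem_range h.base g.pt with ⟨x, hx⟩ | ⟨y, hy⟩
  · exact Or.inl (hleft x hx)
  · by_cases hyA : y ∈ A
    · have h1 : l.base (f.base ⟨y, hyA⟩) = r.base y :=
        congrArg (fun c : TopCat.of A ⟶ TopCat.of BZ => c.hom ⟨y, hyA⟩) h.base.w
      exact Or.inl (hleft _ (h1.trans hy))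
    · obtain ⟨g', hg', hgg⟩ := (h.fibre_right y (by
        rintro ⟨a, ha⟩
        exact hyA (ha ▸ a.2))).exists_postcomp_eq g hy.symm
      exact Or.inr ⟨g', hg' ▸ hyA, hgg⟩

variable [φ.Faithful]

/-- Open sets of `X` which define a basic open set of `X ^ V` contained in `U ⊆ Z ^ V` extend
to open sets of the push-out `Z` which define a basic open set contained in `U`. -/
theorem IsFPushout.exists_isOpen_extension (h : IsFPushout f (Y.restrictIncl A) l r)
    (hφ : IsFibreFunctor φ) (hY : Y.IsBundle) [T2Space BY]
    (hA : ∃ (_ : CWComplex (Set.univ : Set BY))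
      (E : RelCWComplex.Subcomplex (Set.univ : Set BY)), (E : Set BY) = A)
    (hl : Function.Injective l.toMap) {V : F} {J : Type*} [Finite J]
    {K : J → Set (φ.obj V)} (hK : ∀ j, IsCompact (K j)) {j₀ : J}
    (hK₀ : IsProperTest φ V (K j₀)) {U : Set (FunctionSpace Z V)}
    (hU : IsOpen (r.postcomp ⁻¹' U : Set (FunctionSpace Y V))) {O : J → Set X.Total}
    (hO : ∀ j, IsOpen (O j))
    (hOU : ∀ g : FunctionSpace X V, (∀ j, Set.MapsTo g.map (K j) (O j)) → l.postcomp g ∈ U) :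
    ∃ O' : J → Set Z.Total, (∀ j, IsOpen (O' j)) ∧ (∀ j, l.toMap ⁻¹' O' j = O j) ∧
      ∀ g : FunctionSpace Z V, (∀ j, Set.MapsTo g.map (K j) (O' j)) → g ∈ U := by
  obtain ⟨cw, E, rfl⟩ := hA
  have : Nonempty (φ.obj V) := hK₀.nonempty.to_subtype.map Subtype.val
  -- The sets `O j` are pulled back along the attaching map to the part over `E`. An `F`-map over
  -- `E` sending each `K j` into `P j` corresponds to one in `X` sending it into `O j`, hence lies
  -- in the preimage of `U`; this is what the extension lemma needs, with the complement of that
  -- preimage as closed set.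
  let P : J → Set Y.Total := fun j => Subtype.val '' (f.toMap ⁻¹' O j)
  have hEc : IsClosed (Y.proj ⁻¹' (E : Set BY) : Set Y.Total) :=
    E.closed.preimage Y.proj.continuous
  obtain ⟨P', h1, h2, h3⟩ := exists_isOpen_extension_subcomplex hφ hY E hK hK₀
    hU.isClosed_compl (P := P) (fun j => by rintro _ ⟨a, -, rfl⟩; exact a.2)
    (fun j => by
      have hc := hEc.isClosedEmbedding_subtypeVal.isClosedMap _
        ((hO j).preimage f.toMap.continuous).isClosed_compl
      refine (congrArg IsClosed (Set.ext fun y => ⟨fun hy => ?_, ?_⟩)).mpr hc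
      · exact ⟨⟨y, hy.1⟩, fun hy' => hy.2 ⟨_, hy', rfl⟩, rfl⟩
      · rintro ⟨a, ha, rfl⟩
        exact ⟨a.2, by rintro ⟨b, hb, hba⟩; exact ha (Subtype.ext hba ▸ hb)⟩)
    (fun g hg hgE hgP => hg (by
      have e : l.postcomp (f.postcomp (g.codRestrict E hgE)) = r.postcomp g :=
        FunctionSpace.ext_of_forall fun v => h.toMap_eq _
      change r.postcomp g ∈ U
      rw [← e]
      refine hOU _ fun j v hv => ?_
      obtain ⟨b, hb, hba⟩ := hgP j hv
      have : b = (g.codRestrict E hgE).map v := Subtype.ext hba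
      rw [this] at hb
      exact hb))
  have hPl : ∀ j (a : (Y.restrict E).Total), a.1 ∈ P' j → f.toMap a ∈ O j := fun j a ha => by
    have : a.1 ∈ P j := by rw [← h2]; exact ⟨ha, a.2⟩
    obtain ⟨b, hb, hba⟩ := this
    exact Subtype.ext hba ▸ hb
  have hPr : ∀ j (a : (Y.restrict E).Total), f.toMap a ∈ O j → a.1 ∈ P' j := fun j a ha => by
    have : a.1 ∈ P j := ⟨a, ha, rfl⟩
    rw [← h2] at this
    exact this.1
  -- The two sets agree over the attaching region, so the preimages of `O'` are exactly `O` and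
  -- `P'`; openness in the push-out follows.
  let O' : J → Set Z.Total := fun j => l.toMap '' O j ∪ r.toMap '' P' j
  have hlO : ∀ j, l.toMap ⁻¹' O' j = O j := by
    refine fun j => Set.Subset.antisymm ?_ fun x hx => Or.inl ⟨x, hx, rfl⟩
    rintro x (⟨x', hx', he⟩ | ⟨y, hy, he⟩)
    · exact hl he ▸ hx'
    · have hyE := h.mem_of_eq he.symm
      have : f.toMap ⟨y, hyE⟩ = x := hl ((h.toMap_eq _).trans he)
      exact this ▸ hPl j ⟨y, hyE⟩ hy
  have hrO : ∀ j, r.toMap ⁻¹' O' j = P' j := by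
    refine fun j => Set.Subset.antisymm ?_ fun x hx => Or.inr ⟨x, hx, rfl⟩
    rintro y (⟨x, hx, he⟩ | ⟨y', hy', he⟩)
    · have hyE := h.mem_of_eq he
      have : f.toMap ⟨y, hyE⟩ = x := hl ((h.toMap_eq _).trans he.symm)
      exact hPr j ⟨y, hyE⟩ (this.symm ▸ hx)
    · by_cases hyE : Y.proj y ∈ (E : Set BY)
      · by_cases hyE' : Y.proj y' ∈ (E : Set BY)
        · have : f.toMap ⟨y, hyE⟩ = f.toMap ⟨y', hyE'⟩ :=
            hl ((h.toMap_eq _).trans (he.symm.trans (h.toMap_eq ⟨y', hyE'⟩).symm))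
          exact hPr j ⟨y, hyE⟩ (this.symm ▸ hPl j ⟨y', hyE'⟩ hy')
        · exact h.injective_right hyE' he ▸ hy'
      · exact (h.injective_right hyE he.symm).symm ▸ hy'
  refine ⟨O', fun j => (pushout_isOpen_iff h.total).2 ⟨?_, ?_⟩, hlO, fun g hg => ?_⟩
  · exact (hlO j).symm ▸ hO j
  · exact (hrO j).symm ▸ h1 j
  · rcases h.exists_postcomp_eq g with ⟨g', rfl⟩ | ⟨g', -, rfl⟩
    · refine hOU g' fun j v hv => ?_
      rw [← hlO]
      exact hg j hv
    · by_contra hgU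
      refine h3 g' hgU fun j v hv => ?_
      rw [← hrO]
      exact hg j hv

/-- The topology of the function space of a push-out. -/
theorem IsFPushout.isOpen_functionSpace (h : IsFPushout f (Y.restrictIncl A) l r)
    (hφ : IsNKC φ) (hY : Y.IsBundle) [T2Space BY]
    (hA : ∃ (_ : CWComplex (Set.univ : Set BY))
      (E : RelCWComplex.Subcomplex (Set.univ : Set BY)), (E : Set BY) = A)
    (hl : Function.Injective l.toMap) {V : F} [Nonempty (φ.obj V)] {U : Set (FunctionSpace Z V)}
    (hUl : IsOpen (l.postcomp ⁻¹' U : Set (FunctionSpace X V)))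
    (hUr : IsOpen (r.postcomp ⁻¹' U : Set (FunctionSpace Y V))) : IsOpen U := by
  obtain ⟨𝒦, h𝒦, K₀, hK₀, hK₀p⟩ := hφ.exists_isProperTest V
  refine isOpen_iff_mem_nhds.2 fun g hg => ?_
  suffices hn : ∃ (J : Type u) (_ : Finite J) (K : J → Set (φ.obj V)) (O : J → Set Z.Total),
      (∀ j, IsCompact (K j)) ∧ (∀ j, IsOpen (O j)) ∧ (∀ j, Set.MapsTo g.map (K j) (O j)) ∧
      ∀ g' : FunctionSpace Z V, (∀ j, Set.MapsTo g'.map (K j) (O j)) → g' ∈ U by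
    obtain ⟨J, _, K, O, hK, hO, hgO, hOU⟩ := hn
    have ho : IsOpen (⋂ j, {g' : FunctionSpace Z V | Set.MapsTo g'.map (K j) (O j)}) :=
      isOpen_iInter_of_finite fun j => FunctionSpace.isOpen_mapsTo (hK j) (hO j)
    exact Filter.mem_of_superset (ho.mem_nhds (Set.mem_iInter.2 hgO))
      fun g' hg' => hOU g' (Set.mem_iInter.1 hg')
  rcases h.exists_postcomp_eq g with ⟨g, rfl⟩ | ⟨g, hgA, rfl⟩
  -- A point coming from `X` has a basic neighbourhood there, which has to be extended across `Y`.
  · obtain ⟨J, hJ, K, O, hK, ⟨j₀, rfl⟩, hO, hgO, hOU⟩ := h𝒦.exists_basic hK₀ X hUl hg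
    obtain ⟨O', h1, h2, h3⟩ := h.exists_isOpen_extension hφ.isFibreFunctor hY hA hl
      (fun j => h𝒦.isCompact _ (hK j)) hK₀p hUr hO hOU
    refine ⟨J, hJ, K, O', fun j => h𝒦.isCompact _ (hK j), h1, fun j v hv => ?_, h3⟩
    have := hgO j hv
    rw [← h2] at this
    exact this
  -- A point over the complement of `A` needs no extension: `Y` embeds there as an open part of `Z`,
  -- so the open sets can be cut down to it. Non-emptiness of `K₀` then excludes all `F`-maps that
  -- come from `X`.
  · have hAc : IsClosed A := by
      obtain ⟨_, E, rfl⟩ := hA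
      exact E.closed
    obtain ⟨J, hJ, K, O, hK, ⟨j₀, rfl⟩, hO, hgO, hOU⟩ := h𝒦.exists_basic hK₀ Y hUr hg
    obtain ⟨v₀, hv₀⟩ := hK₀p.nonempty
    refine ⟨J, hJ, K, fun j => r.toMap '' (O j ∩ Y.proj ⁻¹' Aᶜ), fun j => h𝒦.isCompact _ (hK j),
      fun j => (pushout_isOpen_iff h.total).2 ⟨?_, ?_⟩, fun j v hv => ?_, fun g' hg' => ?_⟩
    · convert isOpen_empty
      refine Set.eq_empty_of_forall_notMem ?_
      rintro x ⟨y, hy, hxy⟩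
      exact hy.2 (h.mem_of_eq hxy.symm)
    · convert (hO j).inter (hAc.isOpen_compl.preimage Y.proj.continuous) using 1
      refine Set.Subset.antisymm ?_ fun y hy => ⟨y, hy, rfl⟩
      rintro y ⟨y', hy', he⟩
      exact h.injective_right hy'.2 he ▸ hy'
    · refine ⟨g.map v, ⟨hgO j hv, ?_⟩, rfl⟩
      rw [Set.mem_preimage, g.proj_map]
      exact hgA
    · rcases h.exists_postcomp_eq g' with ⟨g', rfl⟩ | ⟨g', hgA', rfl⟩
      · obtain ⟨y, hy, he⟩ := hg' j₀ hv₀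
        exact (hy.2 (h.mem_of_eq he.symm)).elim
      · refine hOU g' fun j v hv => ?_
        obtain ⟨y, hy, he⟩ := hg' j hv
        exact h.injective_right hy.2 he ▸ hy.1

end

end

section

variable {F : Type u} [SmallCategory F] {φ : F ⥤ TopCat.{u}}

/-! ### Function spaces of stratified bundles -/

theorem FunctionSpace.proj_map_mem_iff {B : Type u} [TopologicalSpace B] {Y : FibreFamily φ B}
    {V : F} {f : FunctionSpace Y V} {v : φ.obj V} {A : Set B} :
    Y.proj (f.map v) ∈ A ↔ f.pt ∈ A := by
  rw [f.proj_map]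

theorem FibreFamily.restrictLE_injective {B : Type u} [TopologicalSpace B] (Z : FibreFamily φ B)
    {C C' : Set B} (hC : C ⊆ C') : Function.Injective (Z.restrictLE hC).toMap := fun _ _ h =>
  Subtype.ext (congrArg (fun z : (Z.restrict C').Total => z.1) h)

variable [φ.Faithful]

section

variable {B BY : Type u} [TopologicalSpace B] [TopologicalSpace BY] {X : FibreFamily φ B}
  {Y : FibreFamily φ BY} {A : Set BY} {C C' : Set B} {hC : C ⊆ C'}
  {f : FMap (Y.restrict A) (X.restrict C)} {r : FMap Y (X.restrict C')}

/-- The attaching map `Y ^ V|A → X ^ V|C` induced by an `F`-map `Y|A → X|C`. -/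
noncomputable def attachingMap (f : FMap (Y.restrict A) (X.restrict C)) (V : F)
    [Nonempty (φ.obj V)] :
    FMap ((Y.functionFamily V).restrict A) ((X.functionFamily V).restrict C) :=
  (X.functionToRestrict V C).comp ((f.functionMap V).comp (Y.restrictToFunction V A))

/-- The characteristic map `Y ^ V → X ^ V|C` induced by an `F`-map `Y → X|C`. -/
noncomputable def characteristicMap (r : FMap Y (X.restrict C')) (V : F)
    [Nonempty (φ.obj V)] :
    FMap (Y.functionFamily V) ((X.functionFamily V).restrict C') :=
  (X.functionToRestrict V C').comp (r.functionMap V)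

theorem isFibreIsoAt_characteristicMap {b : BY} (hr : r.IsFibreIsoAt b) (V : F)
    [Nonempty (φ.obj V)] : (characteristicMap r V).IsFibreIsoAt b := by
  obtain ⟨a, a', ha, h1, h2⟩ := hr
  refine ⟨a, a', fun g => ?_, homFunctor_map_comp_eq_id V h1, homFunctor_map_comp_eq_id V h2⟩
  refine (r.functionMap_fibre V ha g.1 g.2).trans ?_
  refine FibreFamily.functionFamily_chart_eq (r.postcomp g.1) (congrArg r.base g.2) _ fun v => ?_
  exact FibreFamily.functionFamily_chart_spec
    ((X.restrictIncl C').postcomp (r.postcomp g.1))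
    (congrArg Subtype.val (congrArg r.base g.2)) v

theorem FibreFamily.restrictLE_isFibreIsoAt {ψ : F ⥤ TopCat.{u}} (Z : FibreFamily ψ B)
    (hC : C ⊆ C') (b : C) : (Z.restrictLE hC).IsFibreIsoAt b := by
  have h : ψ.map (𝟙 (Z.fib b.1)) ≫ ψ.map (𝟙 (Z.fib b.1)) = 𝟙 _ := by
    rw [← ψ.map_comp, Category.comp_id, ψ.map_id]
  exact ⟨𝟙 (Z.fib b.1), 𝟙 (Z.fib b.1),
    fun x => congrArg (fun c => (TopCat.Hom.hom c) _) (ψ.map_id (Z.fib b.1)), h, h⟩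

/-- Since `(X|C) ^ V` and `X ^ V|C` are homeomorphic, openness can be tested in the first, to which
the results on push-outs apply. -/
theorem FibreFamily.isOpen_preimage_functionToRestrict_iff (V : F) [Nonempty (φ.obj V)]
    {U : Set ((X.functionFamily V).restrict C).Total} :
    IsOpen ((X.functionToRestrict V C).toMap ⁻¹' U) ↔ IsOpen U := by
  refine ⟨fun h => ?_, fun h => h.preimage (X.functionToRestrict V C).toMap.continuous⟩
  have := h.preimage (X.restrictToFunction V C).toMap.continuous
  rw [← Set.preimage_comp] at this
  convert this using 1
  ext x
  exact iff_of_eq (congrArg (fun y => y ∈ U)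
    (X.functionToRestrict_restrictToFunction V C x).symm)

/-- The base square is the old one and invertible morphisms on fibres stay invertible under
`homFunctor`. For total spaces, the set-theoretic conditions follow by evaluation and lifting of
`F`-maps, and the condition on open sets is `IsFPushout.isOpen_functionSpace`. -/
theorem IsFPushout.functionSpace
    (h : IsFPushout f (Y.restrictIncl A) (X.restrictLE hC) r) (hφ : IsNKC φ) (hY : Y.IsBundle)
    [T2Space BY] (hA : ∃ (_ : CWComplex (Set.univ : Set BY))
      (E : RelCWComplex.Subcomplex (Set.univ : Set BY)), (E : Set BY) = A)
    (V : F) [Nonempty (φ.obj V)] :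
    IsFPushout (attachingMap f V) ((Y.functionFamily V).restrictIncl A)
      ((X.functionFamily V).restrictLE hC) (characteristicMap r V) where
  base := h.base
  fibre_left := (X.functionFamily V).restrictLE_isFibreIsoAt hC
  fibre_right := fun b hb => isFibreIsoAt_characteristicMap (h.fibre_right b hb) V
  total := by
    have v₀ : φ.obj V := Classical.arbitrary _
    refine isPushout_of_forall ?_ ?_ ?_ ?_ ?_ ?_
    · intro g
      refine Subtype.ext (FunctionSpace.ext_of_forall fun v => ?_)
      exact congrArg Subtype.val (h.toMap_eq ⟨g.1.map v,
        FunctionSpace.proj_map_mem_iff.2 g.2⟩)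
    · exact (X.functionFamily V).restrictLE_injective hC
    · intro g
      have hg := (X.functionToRestrict_restrictToFunction V C' g)
      rcases h.exists_postcomp_eq ((X.restrictToFunction V C').toMap g) with
        ⟨g', hg'⟩ | ⟨g', -, hg'⟩
      · refine Or.inl ⟨(X.functionToRestrict V C).toMap g', ?_⟩
        rw [← hg, ← hg']
        exact Subtype.ext (FunctionSpace.ext_of_forall fun _ => rfl)
      · refine Or.inr ⟨g', ?_⟩
        rw [← hg, ← hg']
        rfl
    · intro g g' hgg
      have hr : r.postcomp g = r.postcomp g' := by
        have := congrArg (X.restrictToFunction V C').toMap hgg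
        exact (X.restrictToFunction_functionToRestrict V C' (r.postcomp g)).symm.trans
          (this.trans (X.restrictToFunction_functionToRestrict V C' (r.postcomp g')))
      have hv : ∀ v, r.toMap (g.map v) = r.toMap (g'.map v) := fun v =>
        congrArg (fun k => FunctionSpace.map k v) hr
      have hpt : ∀ k : FunctionSpace Y V, k.pt ∈ A → k ∈ Set.range
          ((Y.functionFamily V).restrictIncl A).toMap := fun k hk => ⟨⟨k, hk⟩, rfl⟩
      by_cases hg : FunctionSpace.pt g ∈ A
      · by_cases hg' : FunctionSpace.pt g' ∈ A
        · exact Or.inr ⟨hpt g hg, hpt g' hg'⟩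
        · exact Or.inl (FunctionSpace.ext_of_forall fun v =>
            (h.injective_right (mt FunctionSpace.proj_map_mem_iff.1 ‹_›) (hv v).symm).symm)
      · exact Or.inl (FunctionSpace.ext_of_forall fun v =>
            h.injective_right (mt FunctionSpace.proj_map_mem_iff.1 ‹_›) (hv v))
    · intro g g' hgg
      refine ⟨⟨g', ?_⟩, rfl⟩
      have h1 : (X.restrictLE hC).toMap (((X.restrictToFunction V C).toMap g).map v₀) =
          r.toMap (FunctionSpace.map g' v₀) :=
        Subtype.ext (congrArg (fun k => FunctionSpace.map (Subtype.val k) v₀) hgg)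
      exact FunctionSpace.proj_map_mem_iff.1 (h.mem_of_eq h1)
    · intro U hUl hUr
      rw [← FibreFamily.isOpen_preimage_functionToRestrict_iff]
      refine h.isOpen_functionSpace hφ hY hA (X.restrictLE_injective hC) ?_ hUr
      exact FibreFamily.isOpen_preimage_functionToRestrict_iff V |>.2 hUl

end

section

variable {B : Type u} [TopologicalSpace B] {X : FibreFamily φ B}

/-- The function space of a stratified bundle is the colimit of the function spaces of its
strata. -/
theorem IsStratifiedBundle.isCoherentWith_functionSpace {S : StratifiedSpace B}
    (hX : IsStratifiedBundle S X) (hφ : IsNKC φ) (V : F) [Nonempty (φ.obj V)] :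
    IsCoherentWith (Set.range fun i =>
      ((X.functionFamily V).proj ⁻¹' S.filt i : Set (X.functionFamily V).Total)) := by
  obtain ⟨𝒦, h𝒦, K₀, hK₀, hK₀p⟩ := hφ.exists_isProperTest V
  refine ⟨fun (U : Set (FunctionSpace X V)) hU =>
    isOpen_iff_mem_nhds.2 fun (g : FunctionSpace X V) (hg : g ∈ U) => ?_⟩
  have hU' : ∀ i, IsOpen ((X.restrictIncl (S.filt i)).postcomp ⁻¹' U :
      Set (FunctionSpace (X.restrict (S.filt i)) V)) := fun i =>
    FibreFamily.isOpen_preimage_functionToRestrict_iff V |>.2 (hU _ ⟨i, rfl⟩)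
  have hmono : Monotone S.filt := monotone_nat_of_le_succ S.filt_le
  obtain ⟨i₀, hi₀⟩ : ∃ i, FunctionSpace.pt g ∈ S.filt i := by
    have : FunctionSpace.pt g ∈ ⋃ i, S.filt i := by rw [S.iUnion_filt]; trivial
    exact Set.mem_iUnion.1 this
  -- The finite index set and the compact sets are fixed once, at the first chosen stage containing
  -- the base point of `g`; only the open sets are extended through the later strata.
  obtain ⟨J, hJ, K, O₀, hK, ⟨j₀, rfl⟩, hO₀, hgO₀, hOU₀⟩ := h𝒦.exists_basic hK₀ _ (hU' i₀)
    (f := FunctionSpace.codRestrict (S.filt i₀) g hi₀) (by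
      have : (X.restrictIncl (S.filt i₀)).postcomp
        (FunctionSpace.codRestrict (S.filt i₀) g hi₀) = g :=
          FunctionSpace.ext_of_forall fun _ => rfl
      rw [Set.mem_preimage, this]
      exact hg)
  have hKc : ∀ j, IsCompact (K j) := fun j => h𝒦.isCompact _ (hK j)
  let Good : (n : ℕ) → (J → Set (X.restrict (S.filt (i₀ + n))).Total) → Prop := fun n O =>
    (∀ j, IsOpen (O j)) ∧ ∀ g : FunctionSpace (X.restrict (S.filt (i₀ + n))) V,
      (∀ j, Set.MapsTo g.map (K j) (O j)) → (X.restrictIncl (S.filt (i₀ + n))).postcomp g ∈ U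
  have step : ∀ (n : ℕ) (O : {O // Good n O}), ∃ O' : {O // Good (n + 1) O},
      ∀ j, (X.restrictLE (S.filt_le (i₀ + n))).toMap ⁻¹' (O'.1 j) = O.1 j := by
    rintro n ⟨O, hO, hOU⟩
    obtain ⟨M, hM, f, r, -, -, hp⟩ := hX.attaching (i₀ + n)
    obtain ⟨O', h1, h2, h3⟩ := hp.exists_isOpen_extension hφ.isFibreFunctor hM
      (S.cw_pair (i₀ + n)) (X.restrictLE_injective _) hKc hK₀p
      ((hU' (i₀ + n + 1)).preimage (r.continuous_postcomp V)) hO hOU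
    exact ⟨⟨O', h1, h3⟩, h2⟩
  choose next hnext using step
  let O : (n : ℕ) → {O // Good n O} := fun n => Nat.rec ⟨O₀, hO₀, hOU₀⟩ (fun n O => next n O) n
  have hOs : ∀ n j, (X.restrictLE (S.filt_le (i₀ + n))).toMap ⁻¹' ((O (n + 1)).1 j) =
      (O n).1 j := fun n j => hnext n (O n) j
  have hmem : ∀ j n k (x : X.Total) (hx : X.proj x ∈ S.filt (i₀ + n))
      (hx' : X.proj x ∈ S.filt (i₀ + (n + k))),
      (⟨x, hx'⟩ : (X.restrict (S.filt (i₀ + (n + k)))).Total) ∈ (O (n + k)).1 j ↔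
        (⟨x, hx⟩ : (X.restrict (S.filt (i₀ + n))).Total) ∈ (O n).1 j := by
    intro j n k x hx
    induction k with
    | zero => exact fun _ => Iff.rfl
    | succ k ih =>
      intro hx'
      have hx'' : X.proj x ∈ S.filt (i₀ + (n + k)) := hmono (by lia) hx
      rw [← ih hx'', ← hOs (n + k) j]
      rfl
  -- Successive extensions agree on earlier strata, so the union restricts to the chosen open set on
  -- each stratum and is open by the coherence of `X`. Any `F`-map lies over a single point, hence
  -- over one stratum, where the condition of that stage puts it in `U`.
  let O' : J → Set X.Total := fun j => ⋃ n, Subtype.val '' ((O n).1 j)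
  have hO' : ∀ j n (x : X.Total) (hx : X.proj x ∈ S.filt (i₀ + n)), x ∈ O' j ↔
      (⟨x, hx⟩ : (X.restrict (S.filt (i₀ + n))).Total) ∈ (O n).1 j := by
    intro j n x hx
    refine ⟨fun h => ?_, fun h => Set.mem_iUnion.2 ⟨n, _, h, rfl⟩⟩
    obtain ⟨m, ⟨y, hym⟩, hy, rfl⟩ := Set.mem_iUnion.1 h
    rcases le_total m n with hmn | hmn
    · obtain ⟨k, rfl⟩ := Nat.exists_eq_add_of_le hmn
      exact (hmem j m k y hym hx).2 hy
    · obtain ⟨k, rfl⟩ := Nat.exists_eq_add_of_le hmn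
      exact (hmem j n k y hx hym).1 hy
  have hopen : ∀ j, IsOpen (O' j) := by
    refine fun j => hX.coherent.isOpen_of_forall_induced _ ?_
    rintro _ ⟨i, rfl⟩
    have hle : S.filt i ⊆ S.filt (i₀ + i) := hmono (by lia)
    exact (congrArg IsOpen (Set.ext fun x : (X.proj ⁻¹' S.filt i : Set X.Total) =>
      hO' j i x.1 (hle x.2))).mpr
      (((O i).2.1 j).preimage (X.restrictLE hle).toMap.continuous)
  have hnb : IsOpen (⋂ j, {g' : FunctionSpace X V | Set.MapsTo g'.map (K j) (O' j)}) :=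
    isOpen_iInter_of_finite fun j => FunctionSpace.isOpen_mapsTo (hKc j) (hopen j)
  refine Filter.mem_of_superset (hnb.mem_nhds (Set.mem_iInter.2 fun j v hv => ?_))
    fun g' hg' => ?_
  · exact (hO' j 0 _ (FunctionSpace.proj_map_mem_iff.2 hi₀)).2 (hgO₀ j hv)
  · obtain ⟨i, hi⟩ : ∃ i, FunctionSpace.pt g' ∈ S.filt i := by
      have : FunctionSpace.pt g' ∈ ⋃ i, S.filt i := by rw [S.iUnion_filt]; trivial
      exact Set.mem_iUnion.1 this
    have hi' : FunctionSpace.pt g' ∈ S.filt (i₀ + i) := hmono (by lia) hi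
    have e : (X.restrictIncl (S.filt (i₀ + i))).postcomp
        (FunctionSpace.codRestrict (S.filt (i₀ + i)) g' hi') = g' :=
      FunctionSpace.ext_of_forall fun _ => rfl
    rw [← e]
    refine (O i).2.2 _ fun j v hv => ?_
    exact (hO' j i _ _).1 (Set.mem_iInter.1 hg' j hv)

end

end

end StratBundle

/-! ### Assembly of the theorem from bundles, push-outs and the colimit -/

theorem mainTheorem3 {F : Type u} [SmallCategory F] (φ : F ⥤ TopCat.{u}) [φ.Faithful]
    (hφ : IsNKC φ) {B : Type u} [TopologicalSpace B] (S : StratifiedSpace B)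
    (X : FibreFamily φ B) (hX : IsStratifiedBundle S X) (V : F) [Nonempty (φ.obj V)] :
    IsFibreFunctor (homFunctor φ V) ∧ IsStratifiedBundle S (X.functionFamily V) := by
  refine ⟨hφ.isFibreFunctor_homFunctor V, ?_, fun i => ?_,
    hX.isCoherentWith_functionSpace hφ V⟩
  · exact (hX.bundle_zero.functionFamily V).of_fisomorphic
      (X.fisomorphic_functionFamily_restrict V _)
  · obtain ⟨M, hM, h, k, hb, kb, hp⟩ := hX.attaching i
    exact ⟨M.functionFamily V, hM.functionFamily V, attachingMap h V, characteristicMap k V,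
      hb, kb, hp.functionSpace hφ hM (S.cw_pair i) V⟩
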